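/- **Setting.** There are $m$ items and a matroid $([m],\mathcal I)$. Bidder $i$ has nonnegative item values $v_{i1},\dots,v_{im}$, all drawn independently, $v_{ij}\sim F_j$ for every bidder. For a family $\mathcal J$ of sets of items, a bidder is *additive subject to* $\mathcal J$ if her value for a set $S$ is $\max\{\sum_{j\in T}v_{ij} : T\subseteq S,\ T\in\mathcal J\}$; for $\mathcal J=2^{[m]}$ she is *additive*. *Regular* distributions: either (a) all $F_j$ are continuous distributions on $[0,\infty)$ with a density $f_j$ that is positive exactly on an interval, on which the virtual value $\varphi_j(v)=v-\frac{1-F_j(v)}{f_j(v)}$ is nondecreasing; or (b) all $F_j$ have finite support in $[0,\infty)$, on which the discrete virtual value $\varphi_j(v)=v-(v^+-v)\frac{1-F_j(v)}{f_j(v)}$ is nondecreasing, where $v^+$ is the next larger support point, $f_j(v)=\Pr[x=v]$, and the second term is $0$ at the largest support point. Fix one of the two classes throughout. For $F=F_1\times\dots\times F_m$, let $\mathrm{OPT}_{\mathcal J}(F,n)$ be the supremum of the expected revenue over all (possibly randomized) Bayesian incentive compatible, Bayesian individually rational mechanisms for $n$ bidders additive subject to $\mathcal J$ with values from $F$, and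 let $\mathrm{VCG}_{\mathcal J}(F,k)$ be the expected revenue of the VCG mechanism with $k$ such bidders. The *competition complexity* of $n$ bidders additive subject to $\mathcal J$ over $m$ independent, regular items is the least $c\in\mathbb N$ such that $\mathrm{OPT}_{\mathcal J}(F,n)\le \mathrm{VCG}_{\mathcal J}(F,n+c)$ for all products $F$ of $m$ regular distributions ($\infty$ if there is no such $c$). A set $S\not\ni j$ *spans* $j$ if $r(S\cup\{j\})=r(S)$, with $r$ the rank function of the matroid. Let $\rho_j$ be the maximum number of pairwise disjoint independent sets each of which spans $j$. The *disjoint spanning number* of the matroid is $\rho=\max_j\rho_j$ ($0$ if $m=0$). **Theorem (Competition complexity for matroids).** Let $X=X(n,m)$ be the competition complexity of $n$ additive bidders over $m$ independent, regular items, and let $\mathcal I$ be a matroid with disjoint spanning number $\rho$. Then the competition complexity of $n$ bidders that are additive subject to $\mathcal I$ over $m$ independent, regular items is at most $X+\rho$. Moreover, for every integer $c\ge X+\rho$ and every product $F$ of $m$ regular distributions, $\mathrm{OPT}_{\mathcal I}(F,n)\le\mathrm{VCG}_{\mathcal I}(F,n+c)$. -/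

import Mathlib

open MeasureTheory
open scoped ENNReal

noncomputable section

namespace Auction

/-! ### One-dimensional regular distributions -/

/-- A continuous regular distribution: a probability measure on `[0, ∞)` with a Lebesgue density
`f` that is positive exactly on an interval `T` (bounded or not), such that Myerson's virtual value
`φ(v) = v - (1 - F(v)) / f(v)` is nondecreasing on `T`. -/
structure IsRegularContinuous (μ : Measure ℝ) : Prop where
  isProbabilityMeasure : IsProbabilityMeasure μ
  exists_density : ∃ (T : Set ℝ) (f : ℝ → ℝ),
    T.OrdConnected ∧ T ⊆ Set.Ici 0 ∧ Measurable f ∧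
    (∀ v ∈ T, 0 < f v) ∧ (∀ v ∉ T, f v = 0) ∧
    μ = volume.withDensity (fun v => ENNReal.ofReal (f v)) ∧
    MonotoneOn (fun v => v - μ.real (Set.Ioi v) / f v) T

/-- A regular distribution with finite support `T ⊆ [0, ∞)`: Myerson's virtual value
`φ(v) = v - (v⁺ - v) (1 - F(v)) / f(v)` is nondecreasing on `T`, where `f(v)` is the mass of `v` and
`v⁺` is the next larger point of `T`. (At the largest point of `T` one has `1 - F(v) = 0`, and the
second term is zero.) -/
structure IsRegularFinite (μ : Measure ℝ) : Prop where
  isProbabilityMeasure : IsProbabilityMeasure μ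
  exists_support : ∃ T : Finset ℝ,
    (∀ v ∈ T, 0 ≤ v) ∧ (∀ v ∈ T, 0 < μ.real {v}) ∧ μ (T : Set ℝ)ᶜ = 0 ∧
    MonotoneOn
      (fun v => v - (sInf {w | w ∈ T ∧ v < w} - v) * μ.real (Set.Ioi v) / μ.real {v}) T

/-! ### Valuations and allocations -/

/-- The value `max {∑_{j ∈ T} v_j : T ⊆ S, T ∈ 𝓘}` of the bundle `S` for a bidder with item values
`v` who is additive subject to the constraints `𝓘` (a family of sets of items containing `∅`). -/
def value {m : ℕ} (𝓘 : Set (Finset (Fin m))) (v : Fin m → ℝ) (S : Finset (Fin m)) : ℝ :=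
  ⨆ T : {T : Finset (Fin m) // T ⊆ S ∧ T ∈ 𝓘}, ∑ j ∈ T.1, v j

/-- No constraints: on nonnegative item values, `value unconstrained v S = ∑ j ∈ S, v j`. -/
def unconstrained (m : ℕ) : Set (Finset (Fin m)) := Set.univ

/-- The independent sets of a matroid on the items, as a constraint. -/
def matroidConstraint {m : ℕ} (M : Matroid (Fin m)) : Set (Finset (Fin m)) :=
  {I | M.Indep (I : Set (Fin m))}

/-- A (deterministic) allocation of `m` items to `n` bidders: each item is given to one bidder or
stays unallocated. -/
abbrev Allocation (n m : ℕ) : Type := Fin m → Option (Fin n)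

/-- The set of items that bidder `i` receives. -/
def bundle {n m : ℕ} (a : Allocation n m) (i : Fin n) : Finset (Fin m) :=
  Finset.univ.filter fun j => a j = some i

/-- A value profile: `v i j` is the value of bidder `i` for item `j`. -/
abbrev Profile (n m : ℕ) : Type := Fin n → Fin m → ℝ

/-- The law of the value profile of `n` bidders: all values are independent, and every bidder's
value for item `j` is drawn from `F j`. -/
def profileLaw {m : ℕ} (n : ℕ) (F : Fin m → Measure ℝ) : Measure (Profile n m) :=
  Measure.pi fun _ : Fin n => Measure.pi F

/-- The type space of a bidder: the product of the supports of the item distributions. -/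
def typeSpace {m : ℕ} (F : Fin m → Measure ℝ) : Set (Fin m → ℝ) :=
  {t | ∀ j, t j ∈ (F j).support}

/-! ### Mechanisms and the optimal revenue -/

/-- A direct-revelation mechanism, possibly randomized: `alloc v a` is the probability of the
allocation `a` when the reports are `v`, and `pay v i` is the (expected) payment of bidder `i`. -/
structure Mechanism (n m : ℕ) where
  alloc : Profile n m → Allocation n m → ℝ
  pay : Profile n m → Fin n → ℝ
  alloc_nonneg : ∀ v a, 0 ≤ alloc v a
  sum_alloc : ∀ v, ∑ a, alloc v a = 1
  measurable_alloc : ∀ a, Measurable fun v => alloc v a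
  measurable_pay : ∀ i, Measurable fun v => pay v i

namespace Mechanism

variable {n m : ℕ}

/-- The interim expected utility of bidder `i` with true type `t` who reports `r`, when the other
bidders report their true types, which are drawn from `F`. -/
def interimUtility (A : Mechanism n m) (𝓘 : Set (Finset (Fin m))) (F : Fin m → Measure ℝ)
    (i : Fin n) (t r : Fin m → ℝ) : ℝ :=
  ∫ v, (∑ a, A.alloc (Function.update v i r) a * value 𝓘 t (bundle a i)
    - A.pay (Function.update v i r) i) ∂(profileLaw n F)

/-- The interim expected payments are well defined. -/
def HasInterimPayments (A : Mechanism n m) (F : Fin m → Measure ℝ) : Prop :=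
  ∀ i : Fin n, ∀ r ∈ typeSpace F,
    Integrable (fun v => A.pay (Function.update v i r) i) (profileLaw n F)

/-- Bayesian incentive compatibility. -/
def IsBIC (A : Mechanism n m) (𝓘 : Set (Finset (Fin m))) (F : Fin m → Measure ℝ) : Prop :=
  ∀ i : Fin n, ∀ t ∈ typeSpace F, ∀ r ∈ typeSpace F,
    A.interimUtility 𝓘 F i t r ≤ A.interimUtility 𝓘 F i t t

/-- Bayesian individual rationality. -/
def IsBIR (A : Mechanism n m) (𝓘 : Set (Finset (Fin m))) (F : Fin m → Measure ℝ) : Prop :=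
  ∀ i : Fin n, ∀ t ∈ typeSpace F, 0 ≤ A.interimUtility 𝓘 F i t t

/-- The expected revenue under truthful reports, as an extended real number: the sum of the expected
payments of the bidders. The expected payment of a bidder is the expectation of its positive part
minus that of its negative part, and it is `⊥` (as is the revenue) if both are infinite. -/
def revenue (A : Mechanism n m) (F : Fin m → Measure ℝ) : EReal :=
  ∑ i, (((∫⁻ v, ENNReal.ofReal (A.pay v i) ∂(profileLaw n F) : ℝ≥0∞) : EReal)
    - ((∫⁻ v, ENNReal.ofReal (-A.pay v i) ∂(profileLaw n F) : ℝ≥0∞) : EReal))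

end Mechanism

/-- The optimal expected revenue of a BIC and BIR mechanism for `n` bidders who are additive subject
to `𝓘` and whose values are drawn from `F`. -/
def optRevenue {m : ℕ} (𝓘 : Set (Finset (Fin m))) (n : ℕ) (F : Fin m → Measure ℝ) : EReal :=
  ⨆ A : {A : Mechanism n m // A.HasInterimPayments F ∧ A.IsBIC 𝓘 F ∧ A.IsBIR 𝓘 F},
    A.1.revenue F

/-! ### The VCG mechanism -/

section VCG

variable {n m : ℕ}

/-- The welfare of an allocation. -/
def welfare (𝓘 : Set (Finset (Fin m))) (v : Profile n m) (a : Allocation n m) : ℝ :=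
  ∑ i, value 𝓘 (v i) (bundle a i)

/-- The welfare of an allocation for all bidders other than `i`. -/
def welfareOthers (𝓘 : Set (Finset (Fin m))) (v : Profile n m) (i : Fin n)
    (a : Allocation n m) : ℝ :=
  ∑ k ∈ Finset.univ.erase i, value 𝓘 (v k) (bundle a k)

theorem exists_welfare_max (𝓘 : Set (Finset (Fin m))) (v : Profile n m) :
    ∃ a : Allocation n m, ∀ b : Allocation n m, welfare 𝓘 v b ≤ welfare 𝓘 v a :=
  Finite.exists_max (welfare 𝓘 v)

/-- The VCG allocation, a welfare-maximizing one. Ties are broken in an arbitrary way; the total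
VCG payment does not depend on how. -/
def vcgAllocation (𝓘 : Set (Finset (Fin m))) (v : Profile n m) : Allocation n m :=
  Classical.choose (exists_welfare_max 𝓘 v)

/-- The VCG payment of bidder `i`, the externality imposed on the others: the maximal welfare of
the others minus their welfare in the VCG allocation. -/
def vcgPayment (𝓘 : Set (Finset (Fin m))) (v : Profile n m) (i : Fin n) : ℝ :=
  (⨆ b : Allocation n m, welfareOthers 𝓘 v i b) - welfareOthers 𝓘 v i (vcgAllocation 𝓘 v)

end VCG

/-- The expected revenue of VCG (whose payments are nonnegative) for `n` bidders who are additive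
subject to `𝓘` and whose values are drawn from `F`. -/
def vcgRevenue {m : ℕ} (𝓘 : Set (Finset (Fin m))) (n : ℕ) (F : Fin m → Measure ℝ) : ℝ≥0∞ :=
  ∫⁻ v, ENNReal.ofReal (∑ i, vcgPayment 𝓘 v i) ∂(profileLaw n F)

/-! ### Competition complexity -/

/-- For all item distributions in the class `𝒟`, VCG with `n + c` bidders earns at least the
optimal revenue with `n` bidders. -/
def VCGBeatsOpt {m : ℕ} (𝒟 : Measure ℝ → Prop) (𝓘 : Set (Finset (Fin m))) (n c : ℕ) : Prop :=
  ∀ F : Fin m → Measure ℝ, (∀ j, 𝒟 (F j)) →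
    optRevenue 𝓘 n F ≤ (vcgRevenue 𝓘 (n + c) F : EReal)

/-- The competition complexity of `n` bidders who are additive subject to `𝓘` over `m` independent
items with distributions in `𝒟`: the least `c` such that VCG with `n + c` bidders always beats the
optimal revenue with `n` bidders (`⊤` if there is none). -/
def competitionComplexity {m : ℕ} (𝒟 : Measure ℝ → Prop) (𝓘 : Set (Finset (Fin m))) (n : ℕ) :
    ℕ∞ :=
  ⨅ (c : ℕ) (_ : VCGBeatsOpt 𝒟 𝓘 n c), (c : ℕ∞)

/-! ### The disjoint spanning number of a matroid -/

section Matroid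

variable {m : ℕ}

/-- The set `S` spans the element `j ∉ S`: adding `j` does not increase the rank. -/
def Spans (M : Matroid (Fin m)) (S : Finset (Fin m)) (j : Fin m) : Prop :=
  j ∉ S ∧ M.eRk (insert j (S : Set (Fin m))) = M.eRk (S : Set (Fin m))

/-- A family of pairwise disjoint independent sets each of which spans `j`. -/
def IsDisjointSpanningCollection (M : Matroid (Fin m)) (j : Fin m)
    (C : Finset (Finset (Fin m))) : Prop :=
  (∀ I ∈ C, M.Indep (I : Set (Fin m)) ∧ Spans M I j) ∧
    (C : Set (Finset (Fin m))).PairwiseDisjoint id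

open Classical in
/-- The maximum size `ρ_j` of a disjoint spanning collection of `j`. -/
def disjointSpanningNumberAt (M : Matroid (Fin m)) (j : Fin m) : ℕ :=
  (Finset.univ.filter (IsDisjointSpanningCollection M j)).sup Finset.card

/-- The disjoint spanning number `ρ = max_j ρ_j`. -/
def disjointSpanningNumber (M : Matroid (Fin m)) : ℕ :=
  Finset.univ.sup (disjointSpanningNumberAt M)

end Matroid

end Auction

end

/-! The chain is OPT for the matroid ≤ OPT for additive bidders ≤ VCG for `k = n + X` additive
bidders ≤ VCG for the matroid with at least `k + ρ` bidders. The first inequality holds because a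
mechanism can hand every bidder only the best independent part of her bundle
(`optRevenue_le_optRevenue_unconstrained`), and the second is the meaning of `X`. For the third,
additive VCG runs one second-price auction per item and earns at most the sum over the items of the
expected second highest of `k` values. It remains to show that matroid VCG earns at least this much
from every item that is not a loop (`sum_lintegral_secondMax_le_vcgRevenue`).

The maximum weight of an allocation is submodular in the set of items. Hence the payments sum to at
least the sum, over the allocated items `j`, of the marginal worth of `j` to the bidders other than
its winner (`sum_marginal_le_sum_vcgPayment`). That worth is at least the value for `j` of any of
these bidders who is "free": who can take `j` on top of an optimal allocation of the other items. A
bidder who is not free holds an independent set spanning `j`. These sets are disjoint, so at most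
`ρ` bidders are not free (`card_le_card_freeBidders_add`), and at least `k - 1` bidders besides the
winner are.

Who is free does not depend on the values for `j`, which are exchangeable, but the identity of the
winner does depend on them. Fixing the winner `i` leaves exchangeability among the other free
bidders (`permColumn_mem_winEvent`). On that event the second highest of `k` values is at most the
maximum of `k - 1` values of bidders other than `i`, and these can be moved onto free losers
(`lintegral_secondMax_le_sum_setLIntegral`). Ties are removed by adding small uniform noise to all
values.

Submodularity comes from linear programming duality. An ascending auction finds prices whose dual
value is almost the optimum, and the dual is submodular in the prices and the items together because
the maximum weight of an independent set is submodular in the weights.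

Loops are worthless under the matroid but earn revenue from additive bidders, and `X` refers to all
`m` items. So their laws are first replaced by regular laws of the same class below `ε`, from which
the original values can be simulated (`exists_small_law`, `optRevenue_map_le`). -/

noncomputable section

namespace Auction

/-! ### Maximum-weight independent sets: exchange, gross substitutes, submodularity in the weights
-/

section MaxWeight

variable {ι : Type*}

/-- If `J` spans `y`, consider the fundamental circuit of `y` in `J`. Since `y` is not in the
closure of `I` without `y`, neither is some other element `z` of the circuit, for otherwise the
circuit would put `y` there. This `z` can be traded for `y` in both sets at once. -/
theorem exists_symm_exchange [DecidableEq ι] {M : Matroid ι} {I J : Finset ι} (hI : M.Indep (I : Set ι))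
    (hJ : M.Indep (J : Set ι)) {y : ι} (hy : y ∈ I) (hyJ : y ∉ J) :
    M.Indep ((insert y J : Finset ι) : Set ι) ∨ ∃ z ∈ J, z ∉ I ∧
      M.Indep ((insert z (I.erase y) : Finset ι) : Set ι) ∧
      M.Indep ((insert y (J.erase z) : Finset ι) : Set ι) := by
  by_cases hcl : y ∈ M.closure (J : Set ι)
  · right
    have hyE : y ∈ M.E := hI.subset_ground (by simpa using hy)
    have hC := hJ.fundCircuit_isCircuit hcl (by simpa using hyJ)
    have hIy : M.Indep ((I : Set ι) \ {y}) := hI.subset Set.sdiff_subset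
    have hycl : y ∉ M.closure ((I : Set ι) \ {y}) :=
      hI.notMem_closure_sdiff_of_mem (by simpa using hy)
    obtain ⟨z, hzC, hz⟩ :
        ∃ z ∈ M.fundCircuit y J \ {y}, z ∉ M.closure ((I : Set ι) \ {y}) := by
      by_contra! h
      refine hycl (M.closure_subset_closure_of_subset_closure h ?_)
      exact hC.mem_closure_sdiff_singleton_of_mem (M.mem_fundCircuit y J)
    have hzJ : z ∈ J := by
      have := M.fundCircuit_subset_insert y J hzC.1
      simpa [show z ≠ y from hzC.2] using this
    have hzy : z ≠ y := hzC.2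
    have hzE : z ∈ M.E := hJ.subset_ground (by simpa using hzJ)
    have hzI' : z ∉ (I : Set ι) \ {y} := fun h => hz (M.mem_closure_of_mem h hIy.subset_ground)
    refine ⟨z, hzJ, fun h => hzI' ⟨by simpa using h, hzy⟩, ?_, ?_⟩
    · rw [Finset.coe_insert, Finset.coe_erase, hIy.insert_indep_iff]
      exact Or.inl ⟨hzE, hz⟩
    · have := (hJ.mem_fundCircuit_iff hcl (by simpa using hyJ)).1 hzC.1
      rw [Finset.coe_insert, Finset.coe_erase]
      convert this using 1
      ext x; simp only [Set.mem_insert_iff, Set.mem_sdiff, Set.mem_singleton_iff]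
      constructor
      · rintro (rfl | h)
        · exact ⟨Or.inl rfl, hzy.symm⟩
        · exact ⟨Or.inr h.1, h.2⟩
      · rintro ⟨rfl | h, h2⟩
        · exact Or.inl rfl
        · exact Or.inr ⟨h, h2⟩
  · left
    rw [Finset.coe_insert, hJ.insert_indep_iff]
    exact Or.inl ⟨hI.subset_ground (by simpa using hy), hcl⟩

variable [Fintype ι]

/-- The maximum weight of an independent set. -/
def maxWeight (M : Matroid ι) (w : ι → ℝ) : ℝ :=
  ⨆ I : {I : Finset ι // M.Indep (I : Set ι)}, ∑ x ∈ I.1, w x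

theorem le_maxWeight {M : Matroid ι} (w : ι → ℝ) {I : Finset ι} (hI : M.Indep (I : Set ι)) :
    ∑ x ∈ I, w x ≤ maxWeight M w :=
  le_ciSup (f := fun I : {I : Finset ι // M.Indep (I : Set ι)} => ∑ x ∈ I.1, w x)
    (Set.finite_range _).bddAbove ⟨I, hI⟩

theorem exists_maxWeight (M : Matroid ι) (w : ι → ℝ) :
    ∃ I : Finset ι, M.Indep (I : Set ι) ∧ ∑ x ∈ I, w x = maxWeight M w := by
  have : Nonempty {I : Finset ι // M.Indep (I : Set ι)} := ⟨⟨∅, by simp⟩⟩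
  obtain ⟨I, hI⟩ := exists_eq_ciSup_of_finite
    (f := fun I : {I : Finset ι // M.Indep (I : Set ι)} => ∑ x ∈ I.1, w x)
  exact ⟨I.1, I.2, hI⟩

variable [DecidableEq ι]

/-- The gross substitutes property: lowering weights outside of `Y` keeps `Y` in an optimal set. -/
theorem exists_maxWeight_superset {M : Matroid ι} {w w' : ι → ℝ} {I Y : Finset ι}
    (hI : M.Indep (I : Set ι)) (hIw : ∑ x ∈ I, w x = maxWeight M w) (hYI : Y ⊆ I)
    (hle : ∀ x, w' x ≤ w x) (hY : ∀ x ∈ Y, w' x = w x) :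
    ∃ I' : Finset ι, M.Indep (I' : Set ι) ∧ Y ⊆ I' ∧ ∑ x ∈ I', w' x = maxWeight M w' := by
  classical
  obtain ⟨I₀, hI₀, hI₀w⟩ := exists_maxWeight M w'
  -- Among the optimal sets for `w'`, one that meets `Y` as much as possible. An element of `Y`
  -- missing from it could be exchanged in without loss, since swapping in the opposite direction
  -- does not improve `I` for `w`.
  obtain ⟨I', hI', hmax⟩ := Finset.exists_max_image
    (Finset.univ.filter fun I' : Finset ι =>
      M.Indep (I' : Set ι) ∧ ∑ x ∈ I', w' x = maxWeight M w')
    (fun I' => (Y ∩ I').card) ⟨I₀, by simp [hI₀, hI₀w]⟩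
  simp only [Finset.mem_filter, Finset.mem_univ, true_and] at hI' hmax
  refine ⟨I', hI'.1, fun y hy => ?_, hI'.2⟩
  by_contra hyI'
  rcases exists_symm_exchange hI hI'.1 (hYI hy) hyI' with h | ⟨z, hz, hzI, h1, h2⟩
  · have hwy : 0 ≤ w y := by
      have := le_maxWeight w (hI.subset (Finset.coe_subset.2 (Finset.erase_subset y I)))
      rw [← Finset.sum_erase_add I w (hYI hy)] at hIw
      linarith
    have h3 := le_maxWeight w' h
    rw [Finset.sum_insert hyI', hY y hy, hI'.2] at h3
    have h4 := hmax (insert y I') ⟨h, by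
      rw [Finset.sum_insert hyI', hY y hy, hI'.2]; linarith⟩
    refine absurd h4 (not_le.2 (Finset.card_lt_card ?_))
    refine Finset.ssubset_iff_subset_ne.2 ⟨Finset.inter_subset_inter_left
      (Finset.subset_insert _ _), fun h5 => hyI' ?_⟩
    have : y ∈ Y ∩ insert y I' := by simp [hy]
    rw [← h5] at this
    exact (Finset.mem_inter.1 this).2
  · have hzy : w z ≤ w y := by
      have := le_maxWeight w h1
      rw [Finset.sum_insert (by simp [hzI]), ← hIw, ← Finset.sum_erase_add I w (hYI hy)] at this
      linarith
    have hy' : y ∉ I'.erase z := fun h => hyI' (Finset.mem_of_mem_erase h)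
    have h3 := le_maxWeight w' h2
    rw [Finset.sum_insert hy', hY y hy] at h3
    have h5 := Finset.sum_erase_add I' w' hz
    have h6 := hle z
    have h4 := hmax (insert y (I'.erase z)) ⟨h2, by
      rw [Finset.sum_insert hy', hY y hy]
      have := hI'.2
      linarith⟩
    refine absurd h4 (not_le.2 (Finset.card_lt_card ?_))
    have hzY : z ∉ Y := fun h => hzI (hYI h)
    refine Finset.ssubset_iff_subset_ne.2 ⟨fun x hx => ?_, fun h5 => hyI' ?_⟩
    · simp only [Finset.mem_inter, Finset.mem_insert, Finset.mem_erase] at hx ⊢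
      exact ⟨hx.1, Or.inr ⟨fun h => hzY (h ▸ hx.1), hx.2⟩⟩
    · have : y ∈ Y ∩ insert y (I'.erase z) := by simp [hy]
      rw [← h5] at this
      exact (Finset.mem_inter.1 this).2

/-- Take optimal sets `I` and `J` for the two weights on the left. If `y` lies in `I` but not in
`J`, the symmetric exchange moves `y` to `J`, and the element `z` that goes to `I` in return brings
the extra weight `e z ≥ 0`. In all other cases `I` and `J` themselves serve on the right. -/
theorem maxWeight_add_single {M : Matroid ι} (a e : ι → ℝ) (he : ∀ x, 0 ≤ e x) {y : ι}
    (hey : e y = 0) {β : ℝ} (hβ : 0 ≤ β) :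
    maxWeight M (a + e + Pi.single y β) + maxWeight M a
      ≤ maxWeight M (a + e) + maxWeight M (a + Pi.single y β) := by
  have hs : ∀ (w : ι → ℝ) (I : Finset ι), ∑ x ∈ I, (w + Pi.single y β : ι → ℝ) x
      = ∑ x ∈ I, w x + if y ∈ I then β else 0 := fun w I => by
    simp [Finset.sum_add_distrib, Pi.single_apply]
  have hs' : ∀ (I : Finset ι), ∑ x ∈ I, (a + e) x = ∑ x ∈ I, a x + ∑ x ∈ I, e x := fun I => by
    simp only [Pi.add_apply, Finset.sum_add_distrib]
  obtain ⟨I, hI, hIw⟩ := exists_maxWeight M (a + e + Pi.single y β)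
  obtain ⟨J, hJ, hJw⟩ := exists_maxWeight M a
  rw [← hIw, ← hJw]
  by_cases hy : y ∈ I
  · by_cases hyJ : y ∈ J
    · have h1 := le_maxWeight (a + e) hI
      have h2 := le_maxWeight (a + Pi.single y β) hJ
      rw [hs, if_pos hyJ] at h2
      rw [hs, if_pos hy]
      linarith
    · rcases exists_symm_exchange hI hJ hy hyJ with h | ⟨z, hz, hzI, h1, h2⟩
      · have h1 := le_maxWeight (a + e) (hI.subset (Finset.coe_subset.2 (Finset.erase_subset y I)))
        have h2 := le_maxWeight (a + Pi.single y β) h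
        rw [hs, if_pos (by simp), Finset.sum_insert hyJ] at h2
        rw [hs, if_pos hy, ← Finset.sum_erase_add I _ hy]
        have : (a + e) y = a y := by simp [hey]
        linarith
      · have h3 := le_maxWeight (a + e) h1
        have h4 := le_maxWeight (a + Pi.single y β) h2
        rw [hs, if_pos (by simp), Finset.sum_insert (fun h => hyJ (Finset.mem_of_mem_erase h))] at h4
        rw [Finset.sum_insert (by simp [hzI])] at h3
        rw [hs, if_pos hy, ← Finset.sum_erase_add I _ hy, ← Finset.sum_erase_add J _ hz]
        have h5 : (a + e) y = a y := by simp [hey]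
        have h6 : a z ≤ (a + e) z := by simp [he]
        linarith
  · have h1 := le_maxWeight (a + e) hI
    have h2 := le_maxWeight (a + Pi.single y β) hJ
    rw [hs] at h2
    rw [hs, if_neg hy]
    split_ifs at h2 <;> linarith

theorem maxWeight_add_disjoint {M : Matroid ι} (a e f : ι → ℝ) (he : ∀ x, 0 ≤ e x)
    (hf : ∀ x, 0 ≤ f x) (hef : ∀ x, f x ≠ 0 → e x = 0) :
    maxWeight M (a + e + f) + maxWeight M a ≤ maxWeight M (a + e) + maxWeight M (a + f) := by
  suffices h : ∀ s : Finset ι,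
      maxWeight M (a + e + ∑ x ∈ s, Pi.single x (f x)) + maxWeight M a
        ≤ maxWeight M (a + e) + maxWeight M (a + ∑ x ∈ s, Pi.single x (f x)) by
    simpa [Finset.univ_sum_single] using h Finset.univ
  intro s
  induction s using Finset.induction_on with
  | empty => simp
  | insert y s hy ih =>
    rw [Finset.sum_insert hy]
    by_cases hfy : f y = 0
    · simpa [hfy] using ih
    · have := maxWeight_add_single (M := M) (a + ∑ x ∈ s, Pi.single x (f x)) e he (hef y hfy) (hf y)
      have h1 : a + ∑ x ∈ s, Pi.single x (f x) + e + Pi.single y (f y)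
        = a + e + (Pi.single y (f y) + ∑ x ∈ s, Pi.single x (f x)) := by abel
      have h2 : a + ∑ x ∈ s, Pi.single x (f x) + Pi.single y (f y)
        = a + (Pi.single y (f y) + ∑ x ∈ s, Pi.single x (f x)) := by abel
      have h3 : a + ∑ x ∈ s, Pi.single x (f x) + e
        = a + e + ∑ x ∈ s, Pi.single x (f x) := by abel
      rw [h1, h2, h3] at this
      linarith

/-- The increments from `w ⊓ w'` to `w` and to `w'` have disjoint supports, and adding both gives `w
⊔ w'`. -/
theorem maxWeight_sup_add_inf_le (M : Matroid ι) (w w' : ι → ℝ) :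
    maxWeight M (w ⊔ w') + maxWeight M (w ⊓ w') ≤ maxWeight M w + maxWeight M w' := by
  have h := maxWeight_add_disjoint (M := M) (w ⊓ w') (w - w ⊓ w') (w' - w ⊓ w')
    (fun x => by simp) (fun x => by simp)
    (fun x hx => by
      simp only [Pi.sub_apply, Pi.inf_apply] at hx ⊢
      rcases le_total (w x) (w' x) with h | h
      · simp [h]
      · simp [h] at hx)
  have h1 : w ⊓ w' + (w - w ⊓ w') + (w' - w ⊓ w') = w ⊔ w' := by
    ext x
    simp only [Pi.add_apply, Pi.sub_apply, Pi.inf_apply, Pi.sup_apply]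
    rcases le_total (w x) (w' x) with h | h <;> simp [h]
  rw [h1] at h
  simpa using h

end MaxWeight

/-! ### Optimal allocations, dual prices, submodularity in the items -/

section Allocations

variable {n m : ℕ}

/-- Only the items in `S` are allocated, to the bidders in `A`, and every bundle is independent. -/
structure IsFeasible (M : Matroid (Fin m)) (A : Finset (Fin n)) (S : Finset (Fin m))
    (a : Allocation n m) : Prop where
  indep : ∀ i, M.Indep (bundle a i : Set (Fin m))
  mem : ∀ x i, a x = some i → i ∈ A ∧ x ∈ S

/-- The sum of the values of the allocated items for the bidders who receive them. -/
def allocWeight (v : Profile n m) (a : Allocation n m) : ℝ :=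
  ∑ x, (a x).elim 0 fun i => v i x

/-- The maximum weight of a feasible allocation of the items in `S` to the bidders in `A`. -/
def bestWeight (M : Matroid (Fin m)) (A : Finset (Fin n)) (S : Finset (Fin m))
    (v : Profile n m) : ℝ :=
  ⨆ a : {a : Allocation n m // IsFeasible M A S a}, allocWeight v a.1

@[simp]
theorem mem_bundle {a : Allocation n m} {i : Fin n} {x : Fin m} : x ∈ bundle a i ↔ a x = some i := by
  simp [bundle]

theorem isFeasible_none (M : Matroid (Fin m)) (A : Finset (Fin n)) (S : Finset (Fin m)) :
    IsFeasible M A S (fun _ => none) :=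
  ⟨fun i => by simp [bundle], fun x i h => by simp at h⟩

theorem allocWeight_le_bestWeight {M : Matroid (Fin m)} {A : Finset (Fin n)} {S : Finset (Fin m)}
    (v : Profile n m) {a : Allocation n m} (ha : IsFeasible M A S a) :
    allocWeight v a ≤ bestWeight M A S v :=
  le_ciSup (f := fun a : {a : Allocation n m // IsFeasible M A S a} => allocWeight v a.1)
    (Set.finite_range _).bddAbove ⟨a, ha⟩

theorem exists_bestWeight (M : Matroid (Fin m)) (A : Finset (Fin n)) (S : Finset (Fin m))
    (v : Profile n m) : ∃ a, IsFeasible M A S a ∧ allocWeight v a = bestWeight M A S v := by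
  have : Nonempty {a : Allocation n m // IsFeasible M A S a} := ⟨⟨_, isFeasible_none M A S⟩⟩
  obtain ⟨a, ha⟩ := exists_eq_ciSup_of_finite
    (f := fun a : {a : Allocation n m // IsFeasible M A S a} => allocWeight v a.1)
  exact ⟨a.1, a.2, ha⟩

theorem sum_sum_bundle (a : Allocation n m) (A : Finset (Fin n)) (g : Fin n → Fin m → ℝ)
    (hA : ∀ x i, a x = some i → i ∈ A) :
    ∑ i ∈ A, ∑ x ∈ bundle a i, g i x = ∑ x, (a x).elim 0 fun i => g i x := by
  simp only [bundle, Finset.sum_filter]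
  rw [Finset.sum_comm]
  refine Finset.sum_congr rfl fun x _ => ?_
  cases h : a x with
  | none => simp
  | some k => simp [hA x k h]

/-- The value at the prices `p` of the dual of the linear program for `bestWeight`. -/
def dualValue (M : Matroid (Fin m)) (A : Finset (Fin n)) (S : Finset (Fin m))
    (v : Profile n m) (p : Fin m → ℝ) : ℝ :=
  ∑ x ∈ S, p x + ∑ i ∈ A, maxWeight M (v i - p)

theorem bestWeight_le_dualValue (M : Matroid (Fin m)) (A : Finset (Fin n)) (S : Finset (Fin m))
    (v : Profile n m) {p : Fin m → ℝ} (hp : ∀ x, 0 ≤ p x) :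
    bestWeight M A S v ≤ dualValue M A S v p := by
  obtain ⟨a, ha, hav⟩ := exists_bestWeight M A S v
  rw [← hav, dualValue]
  have h1 : ∑ i ∈ A, ∑ x ∈ bundle a i, (v i - p) x ≤ ∑ i ∈ A, maxWeight M (v i - p) :=
    Finset.sum_le_sum fun i _ => le_maxWeight _ (ha.indep i)
  rw [sum_sum_bundle a A (fun i => v i - p) fun x i h => (ha.mem x i h).1] at h1
  have h2 : allocWeight v a ≤ ∑ x ∈ S, p x + ∑ x, (a x).elim 0 fun i => (v i - p) x := by
    rw [← Finset.sum_filter_add_sum_filter_not Finset.univ (· ∈ S)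
      (fun x => (a x).elim 0 fun i => (v i - p) x), allocWeight,
      ← Finset.sum_filter_add_sum_filter_not Finset.univ (· ∈ S), ← add_assoc]
    simp only [Finset.filter_mem_eq_inter, Finset.univ_inter, ← Finset.sum_add_distrib]
    refine add_le_add (Finset.sum_le_sum fun x _ => ?_) (Finset.sum_le_sum fun x hx => ?_)
    · cases a x with
      | none => simpa using hp x
      | some i => simp
    · cases h : a x with
      | none => simp
      | some i => exact absurd (ha.mem x i h).2 (by simpa using hx)
  linarith

/-- A state of the ascending auction with price increments `ε`: the allocation `a` and the prices
`ε * k x`. Every bidder holds part of an optimal set at the prices she faces, which are larger by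
`ε` for the items she does not hold. -/
structure IsAuctionState (M : Matroid (Fin m)) (A : Finset (Fin n)) (v : Profile n m) (ε : ℝ)
    (a : Allocation n m) (k : Fin m → ℕ) : Prop where
  eq_zero : ∀ x, a x = none → k x = 0
  mem : ∀ x i, a x = some i → i ∈ A
  demand : ∀ i ∈ A, ∃ I : Finset (Fin m), M.Indep (I : Set (Fin m)) ∧ bundle a i ⊆ I ∧
    ∑ x ∈ I, (v i x - ε * (k x + if a x = some i then 0 else 1))
      = maxWeight M fun x => v i x - ε * (k x + if a x = some i then 0 else 1)

/-- One step of the auction: a bidder whose bundle is not optimal at the prices she faces takes all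
of an optimal superset, and each newly taken item becomes dearer by one increment. The others may
lose items and face higher prices, but by gross substitutes what they keep is still part of an
optimal set. -/
theorem IsAuctionState.exists_next {M : Matroid (Fin m)} {A : Finset (Fin n)} {v : Profile n m}
    {ε : ℝ} (hε : 0 < ε) {a : Allocation n m} {k : Fin m → ℕ} (h : IsAuctionState M A v ε a k)
    {N : ℕ} (hN : ∀ i x, v i x ≤ ε * N) (hk : ∀ x, k x ≤ N) {i : Fin n} (hi : i ∈ A)
    (hne : ∑ x ∈ bundle a i, (v i x - ε * (k x + if a x = some i then 0 else 1))
      ≠ maxWeight M fun x => v i x - ε * (k x + if a x = some i then 0 else 1)) :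
    ∃ a' k', IsAuctionState M A v ε a' k' ∧ (∀ x, k' x ≤ N) ∧ ∑ x, k x < ∑ x, k' x := by
  obtain ⟨I, hI, hIb, hIw⟩ := h.demand i hi
  let a' : Allocation n m := fun x => if x ∈ I then some i else a x
  let k' : Fin m → ℕ := fun x => if x ∈ I ∧ a x ≠ some i then k x + 1 else k x
  have hle : ∀ x, k x ≤ k' x := fun x => by simp only [k']; split_ifs <;> omega
  refine ⟨a', k', ⟨fun x hx => ?_, fun x l hx => ?_, fun l hl => ?_⟩, fun x => ?_, ?_⟩
  · simp only [a'] at hx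
    split_ifs at hx with hxI
    simp [k', hxI, h.eq_zero x hx]
  · simp only [a'] at hx
    split_ifs at hx with hxI
    · simp only [Option.some.injEq] at hx; rwa [← hx]
    · exact h.mem x l hx
  · rcases eq_or_ne l i with rfl | hli
    · have hb : bundle a' l = I := by
        ext x
        simp only [mem_bundle, a']
        split_ifs with hxI
        · simp [hxI]
        · simp only [hxI, iff_false]
          exact fun hx => hxI (hIb (by simpa using hx))
      have hw : (fun x => v l x - ε * (k' x + if a' x = some l then 0 else 1))
          = fun x => v l x - ε * (k x + if a x = some l then 0 else 1) := by
        ext x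
        by_cases hxI : x ∈ I
        · by_cases hax : a x = some l <;> simp [a', k', hxI, hax]
        · simp [a', k', hxI]
      refine ⟨I, hI, hb.subset, ?_⟩
      rw [hw, ← hIw]
    · obtain ⟨J, hJ, hJb, hJw⟩ := h.demand l hl
      have hsub : ∀ x, a' x = some l → x ∉ I ∧ a x = some l := fun x hx => by
        simp only [a'] at hx
        split_ifs at hx with hxI
        · exact absurd (Option.some.inj hx).symm hli
        · exact ⟨hxI, hx⟩
      refine exists_maxWeight_superset hJ hJw (fun x hx => hJb ?_) (fun x => ?_) fun x hx => ?_
      · simpa using (hsub x (by simpa using hx)).2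
      · have h1 : (k x : ℝ) ≤ k' x := by exact_mod_cast hle x
        have h2 : (if a x = some l then (0 : ℝ) else 1) ≤ if a' x = some l then 0 else 1 := by
          by_cases hx : a' x = some l
          · simp [hx, (hsub x hx).2]
          · rw [if_neg hx]; split_ifs <;> norm_num
        have := mul_le_mul_of_nonneg_left (add_le_add h1 h2) hε.le
        linarith
      · have hx' := hsub x (by simpa using hx)
        simp [k', hx'.1, hx'.2, (by simpa using hx : a' x = some l)]
  -- An element of an optimal set has nonnegative weight, so a newly taken item satisfies `ε * (k x
  -- + 1) ≤ v i x ≤ ε * N`. Prices therefore never pass the cap.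
  · by_cases hx : x ∈ I ∧ a x ≠ some i
    · have h1 := le_maxWeight (fun x => v i x - ε * (k x + if a x = some i then 0 else 1))
        (hI.subset (Finset.coe_subset.2 (Finset.erase_subset x I)))
      rw [← hIw, ← Finset.sum_erase_add I _ hx.1, if_neg hx.2] at h1
      have h2 : ε * ((k x : ℝ) + 1) ≤ ε * N := by linarith [hN i x]
      have h3 : (k x : ℝ) + 1 ≤ N := le_of_mul_le_mul_left h2 hε
      simp only [k', if_pos hx]
      exact_mod_cast h3
    · simpa only [k', if_neg hx] using hk x
  · have hex : ∃ x ∈ I, a x ≠ some i := by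
      by_contra! hcon
      refine hne ?_
      rw [← hIw]
      refine Finset.sum_congr (hIb.antisymm fun x hx => ?_) fun _ _ => rfl
      simpa using hcon x hx
    obtain ⟨x, hx, hax⟩ := hex
    exact Finset.sum_lt_sum (fun x _ => hle x) ⟨x, Finset.mem_univ x, by simp [k', hx, hax]⟩

/-- When the auction stops, every bundle is optimal at the faced prices and unallocated items are
free. The prices then satisfy complementary slackness up to `ε` for each bidder and item. -/
theorem exists_dualValue_univ_le (M : Matroid (Fin m)) (A : Finset (Fin n)) (v : Profile n m)
    {ε : ℝ} (hε : 0 < ε) :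
    ∃ p : Fin m → ℝ, (∀ x, 0 ≤ p x) ∧
      dualValue M A Finset.univ v p ≤ bestWeight M A Finset.univ v + ε * (n * m) := by
  obtain ⟨N, hN⟩ : ∃ N : ℕ, ∀ i x, v i x ≤ ε * N := by
    obtain ⟨C, hC⟩ := (Set.finite_range fun q : Fin n × Fin m => v q.1 q.2).bddAbove
    obtain ⟨N, hN⟩ := exists_nat_ge (C / ε)
    refine ⟨N, fun i x => (hC ⟨(i, x), rfl⟩).trans ?_⟩
    rw [div_le_iff₀ hε] at hN
    linarith
  obtain ⟨⟨a, k⟩, hs, hmax⟩ := (Set.toFinite {q : Allocation n m × (Fin m → Fin (N + 1)) |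
    IsAuctionState M A v ε q.1 fun x => q.2 x}).exists_maximalFor
    (fun q => ∑ x, (q.2 x : ℕ)) _ ⟨(fun _ => none, fun _ => 0), by
      refine ⟨fun x _ => rfl, fun x i h => by simp at h, fun i _ => ?_⟩
      obtain ⟨I, hI, hIw⟩ := exists_maxWeight M
        (fun x => v i x - ε * (((0 : ℕ) : ℝ) + if (none : Option (Fin n)) = some i then 0 else 1))
      exact ⟨I, hI, by simp [bundle], hIw⟩⟩
  simp only [Set.mem_ofPred_eq] at hs hmax
  -- The state has maximal total price, so no further step is possible.
  have hopt : ∀ i ∈ A, ∑ x ∈ bundle a i, (v i x - ε * ((k x : ℕ) + if a x = some i then 0 else 1))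
      = maxWeight M fun x => v i x - ε * ((k x : ℕ) + if a x = some i then 0 else 1) := by
    intro i hi
    by_contra hne
    obtain ⟨a', k', hs', hk', hlt⟩ := hs.exists_next hε hN (fun x => Nat.lt_succ_iff.1 (k x).2) hi hne
    have := hmax (j := (a', fun x => ⟨k' x, Nat.lt_succ_iff.2 (hk' x)⟩)) hs' hlt.le
    simp only at this
    omega
  refine ⟨fun x => ε * (k x : ℕ), fun x => by positivity, ?_⟩
  have hfeas : IsFeasible M A Finset.univ a := by
    refine ⟨fun i => ?_, fun x i h => ⟨hs.mem x i h, Finset.mem_univ x⟩⟩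
    by_cases hi : i ∈ A
    · obtain ⟨I, hI, hb, -⟩ := hs.demand i hi
      exact hI.subset (Finset.coe_subset.2 hb)
    · have : bundle a i = ∅ := by
        ext x; simpa using fun h => hi (hs.mem x i h)
      simp [this]
  have hU : ∀ i ∈ A, maxWeight M (v i - fun x => ε * (k x : ℕ))
      ≤ ∑ x ∈ bundle a i, (v i x - ε * (k x : ℕ)) + ε * m := by
    intro i hi
    obtain ⟨I, hI, hIw⟩ := exists_maxWeight M (v i - fun x => ε * (k x : ℕ))
    have h1 := le_maxWeight
      (fun x => v i x - ε * ((k x : ℕ) + if a x = some i then 0 else 1)) hI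
    rw [← hopt i hi] at h1
    have h2 : ∑ x ∈ bundle a i, (v i x - ε * ((k x : ℕ) + if a x = some i then 0 else 1))
        = ∑ x ∈ bundle a i, (v i x - ε * (k x : ℕ)) :=
      Finset.sum_congr rfl fun x hx => by rw [if_pos (by simpa using hx), add_zero]
    have h3 : ∑ x ∈ I, (v i - fun x => ε * ((k x : ℕ) : ℝ)) x
        ≤ ∑ x ∈ I, (v i x - ε * ((k x : ℕ) + if a x = some i then 0 else 1)) + ∑ x ∈ I, ε := by
      rw [← Finset.sum_add_distrib]
      refine Finset.sum_le_sum fun x _ => ?_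
      simp only [Pi.sub_apply]
      split_ifs <;> nlinarith
    have h4 : ∑ x ∈ I, ε ≤ ε * m := by
      rw [Finset.sum_const, nsmul_eq_mul, mul_comm]
      have : (I.card : ℝ) ≤ m := by exact_mod_cast (Finset.card_le_univ I).trans (by simp)
      exact mul_le_mul_of_nonneg_left this hε.le
    linarith
  have hsum := Finset.sum_le_sum hU
  rw [Finset.sum_add_distrib, sum_sum_bundle a A (fun i x => v i x - ε * (k x : ℕ)) hs.mem,
    Finset.sum_const, nsmul_eq_mul] at hsum
  have hw : ∑ x, ε * ((k x : ℕ) : ℝ) + ∑ x, (a x).elim 0 (fun i => v i x - ε * (k x : ℕ))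
      = allocWeight v a := by
    rw [allocWeight, ← Finset.sum_add_distrib]
    refine Finset.sum_congr rfl fun x _ => ?_
    cases h : a x with
    | none => simp [hs.eq_zero x h]
    | some i => simp
  have hA : (A.card : ℝ) * (ε * m) ≤ ε * (n * m) := by
    have : (A.card : ℝ) ≤ n := by exact_mod_cast (Finset.card_le_univ A).trans (by simp)
    have := mul_le_mul_of_nonneg_right this (by positivity : 0 ≤ ε * (m : ℝ))
    linarith
  have := allocWeight_le_bestWeight v hfeas
  rw [dualValue]
  linarith

theorem exists_dualValue_le (M : Matroid (Fin m)) (A : Finset (Fin n)) (S : Finset (Fin m))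
    (v : Profile n m) {ε : ℝ} (hε : 0 < ε) :
    ∃ p : Fin m → ℝ, (∀ x, 0 ≤ p x) ∧ dualValue M A S v p ≤ bestWeight M A S v + ε := by
  obtain ⟨p, hp, hle⟩ := exists_dualValue_univ_le (M.restrict S) A v
    (div_pos hε (by positivity : 0 < ((n : ℝ) * m + 1)))
  obtain ⟨C, hC⟩ := (Set.finite_range fun q : Fin n × Fin m => v q.1 q.2).bddAbove
  -- Items outside `S` are priced at an upper bound of all values, so nobody gains by demanding
  -- them. They do not enter the price sum of the dual.
  refine ⟨fun x => if x ∈ S then p x else max C 0, fun x => ?_, ?_⟩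
  · dsimp only
    split_ifs
    · exact hp x
    · exact le_max_right _ _
  · have h1 : ε / (n * m + 1) * (n * m) ≤ ε := by
      rw [div_mul_eq_mul_div, div_le_iff₀ (by positivity)]
      nlinarith
    have h2 : bestWeight (M.restrict S) A Finset.univ v ≤ bestWeight M A S v := by
      obtain ⟨a, ha, hav⟩ := exists_bestWeight (M.restrict S) A Finset.univ v
      rw [← hav]
      have hi := fun i => Matroid.restrict_indep_iff.1 (ha.indep i)
      exact allocWeight_le_bestWeight v ⟨fun i => (hi i).1, fun x i h =>
        ⟨(ha.mem x i h).1, by simpa using (hi i).2 (by simpa using h : x ∈ (bundle a i : Set _))⟩⟩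
    refine le_trans ?_ ((hle.trans (add_le_add h2 h1)))
    refine add_le_add ?_ (Finset.sum_le_sum fun i _ => ?_)
    · rw [Finset.sum_ite_of_true fun x hx => hx]
      exact Finset.sum_le_sum_of_subset_of_nonneg (Finset.subset_univ S) fun x _ _ => hp x
    · obtain ⟨I, hI, hIw⟩ := exists_maxWeight M
        (v i - fun x => if x ∈ S then p x else max C 0)
      rw [← hIw]
      have hIS : (M.restrict S).Indep ((I ∩ S : Finset (Fin m)) : Set (Fin m)) := by
        rw [Matroid.restrict_indep_iff]
        exact ⟨hI.subset (Finset.coe_subset.2 Finset.inter_subset_left),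
          Finset.coe_subset.2 Finset.inter_subset_right⟩
      refine le_trans ?_ (le_maxWeight (v i - p) hIS)
      rw [← Finset.sum_inter_add_sum_sdiff I S]
      have h3 : ∑ x ∈ I \ S, (v i - fun x => if x ∈ S then p x else max C 0) x ≤ 0 := by
        refine Finset.sum_nonpos fun x hx => ?_
        have := (Finset.mem_sdiff.1 hx).2
        simp only [Pi.sub_apply, if_neg this]
        linarith [hC ⟨(i, x), rfl⟩, le_max_left C 0]
      have h4 : ∑ x ∈ I ∩ S, (v i - fun x => if x ∈ S then p x else max C 0) x
          = ∑ x ∈ I ∩ S, (v i - p) x := Finset.sum_congr rfl fun x hx => by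
        simp [(Finset.mem_inter.1 hx).2]
      linarith

/-- The maximum weight of an allocation is submodular in the set of items. -/
theorem bestWeight_union_add_inter_le (M : Matroid (Fin m)) (A : Finset (Fin n))
    (S T : Finset (Fin m)) (v : Profile n m) :
    bestWeight M A (S ∪ T) v + bestWeight M A (S ∩ T) v
      ≤ bestWeight M A S v + bestWeight M A T v := by
  refine le_of_forall_pos_le_add fun ε hε => ?_
  obtain ⟨p, hp, hpS⟩ := exists_dualValue_le M A S v (half_pos hε)
  obtain ⟨q, hq, hqT⟩ := exists_dualValue_le M A T v (half_pos hε)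
  -- The pointwise minimum of the prices serves the union, where more items are supplied, and the
  -- maximum serves the intersection.
  have h1 := bestWeight_le_dualValue M A (S ∪ T) v (p := p ⊓ q) fun x => le_min (hp x) (hq x)
  have h2 := bestWeight_le_dualValue M A (S ∩ T) v (p := p ⊔ q) fun x => (hp x).trans (le_max_left _ _)
  have h3 : ∑ i ∈ A, maxWeight M (v i - p ⊓ q) + ∑ i ∈ A, maxWeight M (v i - p ⊔ q)
      ≤ ∑ i ∈ A, maxWeight M (v i - p) + ∑ i ∈ A, maxWeight M (v i - q) := by
    rw [← Finset.sum_add_distrib, ← Finset.sum_add_distrib]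
    refine Finset.sum_le_sum fun i _ => ?_
    have := maxWeight_sup_add_inf_le M (v i - p) (v i - q)
    have e1 : (v i - p) ⊔ (v i - q) = v i - p ⊓ q := by
      ext x; exact max_sub_sub_left (v i x) (p x) (q x)
    have e2 : (v i - p) ⊓ (v i - q) = v i - p ⊔ q := by
      ext x; exact min_sub_sub_left (v i x) (p x) (q x)
    rwa [e1, e2] at this
  have h4 : ∑ x ∈ S ∪ T, (p ⊓ q) x + ∑ x ∈ S ∩ T, (p ⊔ q) x ≤ ∑ x ∈ S, p x + ∑ x ∈ T, q x := by
    have e : ∀ (U : Finset (Fin m)) (f : Fin m → ℝ), ∑ x ∈ U, f x = ∑ x, if x ∈ U then f x else 0 :=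
      fun U f => by simp
    rw [e (S ∪ T), e (S ∩ T), e S, e T, ← Finset.sum_add_distrib, ← Finset.sum_add_distrib]
    refine Finset.sum_le_sum fun x _ => ?_
    by_cases hS : x ∈ S <;> by_cases hT : x ∈ T <;> simp [hS, hT]
  simp only [dualValue] at *
  linarith

end Allocations

/-! ### VCG payments and marginal values of items -/

section Payments

variable {n m : ℕ}

theorem sum_le_value {𝓘 : Set (Finset (Fin m))} (v : Fin m → ℝ) {S T : Finset (Fin m)}
    (hTS : T ⊆ S) (hT : T ∈ 𝓘) : ∑ j ∈ T, v j ≤ value 𝓘 v S :=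
  le_ciSup (f := fun T : {T : Finset (Fin m) // T ⊆ S ∧ T ∈ 𝓘} => ∑ j ∈ T.1, v j)
    (Set.finite_range _).bddAbove ⟨T, hTS, hT⟩

theorem exists_sum_eq_value {𝓘 : Set (Finset (Fin m))} (h𝓘 : ∅ ∈ 𝓘) (v : Fin m → ℝ)
    (S : Finset (Fin m)) : ∃ T ⊆ S, T ∈ 𝓘 ∧ ∑ j ∈ T, v j = value 𝓘 v S := by
  have : Nonempty {T : Finset (Fin m) // T ⊆ S ∧ T ∈ 𝓘} := ⟨⟨∅, by simp, h𝓘⟩⟩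
  obtain ⟨T, hT⟩ := exists_eq_ciSup_of_finite
    (f := fun T : {T : Finset (Fin m) // T ⊆ S ∧ T ∈ 𝓘} => ∑ j ∈ T.1, v j)
  exact ⟨T.1, T.2.1, T.2.2, hT⟩

theorem empty_mem_matroidConstraint (M : Matroid (Fin m)) : ∅ ∈ matroidConstraint M := by
  simp [matroidConstraint]

theorem sum_value_le_bestWeight (M : Matroid (Fin m)) (A : Finset (Fin n)) (v : Profile n m)
    (a : Allocation n m) :
    ∑ i ∈ A, value (matroidConstraint M) (v i) (bundle a i) ≤ bestWeight M A Finset.univ v := by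
  choose T hTS hT hTv using fun i =>
    exists_sum_eq_value (empty_mem_matroidConstraint M) (v i) (bundle a i)
  let a' : Allocation n m := fun x => (a x).bind fun i => if i ∈ A ∧ x ∈ T i then some i else none
  have ha' : ∀ x i, a' x = some i ↔ i ∈ A ∧ x ∈ T i := fun x i => by
    simp only [a']
    constructor
    · intro h
      cases hax : a x with
      | none => simp [hax] at h
      | some k =>
        rw [hax, Option.bind_some] at h
        split_ifs at h with hk
        rw [← Option.some.inj h]
        exact hk
    · rintro ⟨hi, hx⟩
      have := hTS i hx
      rw [mem_bundle] at this
      simp [this, hi, hx]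
  have hb : ∀ i ∈ A, bundle a' i = T i := fun i hi => by ext x; simp [ha', hi]
  have hfeas : IsFeasible M A Finset.univ a' := by
    refine ⟨fun i => ?_, fun x i h => ⟨((ha' x i).1 h).1, Finset.mem_univ x⟩⟩
    by_cases hi : i ∈ A
    · rw [hb i hi]; exact hT i
    · have : bundle a' i = ∅ := by ext x; simp [ha', hi]
      simp [this]
  refine le_trans (le_of_eq ?_) (allocWeight_le_bestWeight v hfeas)
  rw [allocWeight, ← sum_sum_bundle a' A v fun x i h => ((ha' x i).1 h).1]
  exact Finset.sum_congr rfl fun i hi => by rw [hb i hi, hTv]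

theorem exists_sum_value_eq_bestWeight (M : Matroid (Fin m)) (A : Finset (Fin n))
    (v : Profile n m) : ∃ a : Allocation n m,
    ∑ i ∈ A, value (matroidConstraint M) (v i) (bundle a i) = bestWeight M A Finset.univ v := by
  obtain ⟨a, ha, hav⟩ := exists_bestWeight M A Finset.univ v
  refine ⟨a, (sum_value_le_bestWeight M A v a).antisymm ?_⟩
  rw [← hav, allocWeight, ← sum_sum_bundle a A v fun x i h => (ha.mem x i h).1]
  exact Finset.sum_le_sum fun i _ => sum_le_value _ subset_rfl (ha.indep i)

theorem iSup_welfareOthers (M : Matroid (Fin m)) (v : Profile n m) (i : Fin n) :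
    ⨆ b : Allocation n m, welfareOthers (matroidConstraint M) v i b
      = bestWeight M (Finset.univ.erase i) Finset.univ v := by
  obtain ⟨a, ha⟩ := exists_sum_value_eq_bestWeight M (Finset.univ.erase i) v
  refine le_antisymm (ciSup_le fun b => sum_value_le_bestWeight M _ v b) ?_
  rw [← ha]
  exact le_ciSup (f := fun b => welfareOthers (matroidConstraint M) v i b)
    (Set.finite_range _).bddAbove a

theorem welfare_vcgAllocation (M : Matroid (Fin m)) (v : Profile n m) :
    welfare (matroidConstraint M) v (vcgAllocation (matroidConstraint M) v)
      = bestWeight M Finset.univ Finset.univ v := by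
  obtain ⟨a, ha⟩ := exists_sum_value_eq_bestWeight M Finset.univ v
  refine le_antisymm (sum_value_le_bestWeight M _ v _) ?_
  rw [← ha]
  exact Classical.choose_spec (exists_welfare_max (matroidConstraint M) v) a

theorem sum_welfareOthers (𝓘 : Set (Finset (Fin m))) (v : Profile n m) (a : Allocation n m) :
    ∑ i, welfareOthers 𝓘 v i a = n * welfare 𝓘 v a - welfare 𝓘 v a := by
  have : ∀ i, welfareOthers 𝓘 v i a = welfare 𝓘 v a - value 𝓘 (v i) (bundle a i) := fun i => by
    rw [welfare, welfareOthers, ← Finset.sum_erase_add _ _ (Finset.mem_univ i), add_sub_cancel_right]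
  simp only [this, Finset.sum_sub_distrib]
  simp [welfare]

/-- Only optimal weights remain, so the total does not depend on the tie-breaking in `vcgAllocation`
and may be computed with any feasible optimal allocation. -/
theorem sum_vcgPayment (M : Matroid (Fin m)) (v : Profile n m) :
    ∑ i, vcgPayment (matroidConstraint M) v i
      = ∑ i, bestWeight M (Finset.univ.erase i) Finset.univ v
        - (n * bestWeight M Finset.univ Finset.univ v - bestWeight M Finset.univ Finset.univ v) := by
  simp only [vcgPayment, Finset.sum_sub_distrib, iSup_welfareOthers, sum_welfareOthers,
    welfare_vcgAllocation]

/-- Remove the items of `D` one at a time: by submodularity, each removal costs at least what it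
costs when all the other items are present. -/
theorem sum_marginal_le (M : Matroid (Fin m)) (A : Finset (Fin n)) (v : Profile n m)
    (D : Finset (Fin m)) :
    ∑ j ∈ D, (bestWeight M A Finset.univ v - bestWeight M A (Finset.univ.erase j) v)
      ≤ bestWeight M A Finset.univ v - bestWeight M A (Finset.univ \ D) v := by
  induction D using Finset.induction_on with
  | empty => simp
  | insert j D hj ih =>
    rw [Finset.sum_insert hj]
    have h := bestWeight_union_add_inter_le M A (Finset.univ \ D) (Finset.univ.erase j) v
    have h1 : (Finset.univ \ D) ∪ Finset.univ.erase j = Finset.univ := by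
      ext x; simp only [Finset.mem_union, Finset.mem_sdiff, Finset.mem_univ, true_and,
        Finset.mem_erase, and_true, iff_true]
      by_cases hx : x = j
      · left; rwa [hx]
      · exact Or.inr hx
    have h2 : (Finset.univ \ D) ∩ Finset.univ.erase j = Finset.univ \ insert j D := by
      ext x; simp [and_comm]
    rw [h1, h2] at h
    linarith

/-- Bidder `i`'s externality is at least the loss to the others from removing her whole bundle,
because what they hold in `a` is feasible without it. By submodularity that loss is at least the sum
of the losses item by item. -/
theorem sum_marginal_le_sum_vcgPayment {M : Matroid (Fin m)} {v : Profile n m}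
    {a : Allocation n m} (ha : IsFeasible M Finset.univ Finset.univ a)
    (hav : allocWeight v a = bestWeight M Finset.univ Finset.univ v) :
    ∑ j, (a j).elim 0 (fun i => bestWeight M (Finset.univ.erase i) Finset.univ v
        - bestWeight M (Finset.univ.erase i) (Finset.univ.erase j) v)
      ≤ ∑ i, vcgPayment (matroidConstraint M) v i := by
  rw [← sum_sum_bundle a Finset.univ (fun i j => bestWeight M (Finset.univ.erase i) Finset.univ v
        - bestWeight M (Finset.univ.erase i) (Finset.univ.erase j) v)
        fun x i _ => Finset.mem_univ i]
  have h1 : ∀ i, allocWeight v a - ∑ x ∈ bundle a i, v i x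
      ≤ bestWeight M (Finset.univ.erase i) (Finset.univ \ bundle a i) v := fun i => by
    let a' : Allocation n m := fun x => if a x = some i then none else a x
    have hf : IsFeasible M (Finset.univ.erase i) (Finset.univ \ bundle a i) a' := by
      refine ⟨fun l => (ha.indep l).subset fun x hx => ?_, fun x l hx => ?_⟩
      · simp only [Finset.mem_coe, mem_bundle, a'] at hx ⊢
        split_ifs at hx
        exact hx
      · simp only [a'] at hx
        split_ifs at hx with h
        simp only [Finset.mem_erase, Finset.mem_univ, and_true, Finset.mem_sdiff, mem_bundle, h,
          not_false_eq_true]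
        rintro rfl
        exact h hx
    refine le_trans (le_of_eq ?_) (allocWeight_le_bestWeight v hf)
    rw [allocWeight, allocWeight, sub_eq_iff_eq_add, bundle, Finset.sum_filter,
      ← Finset.sum_add_distrib]
    refine Finset.sum_congr rfl fun x _ => ?_
    by_cases h : a x = some i <;> simp [a', h]
  have h2 := Finset.sum_le_sum fun i (_ : i ∈ Finset.univ) =>
    (sum_marginal_le M (Finset.univ.erase i) v (bundle a i)).trans (sub_le_sub_left (h1 i) _)
  refine h2.trans (le_of_eq ?_)
  rw [sum_vcgPayment, Finset.sum_sub_distrib, Finset.sum_sub_distrib,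
    sum_sum_bundle a Finset.univ v fun x i _ => Finset.mem_univ i, ← hav]
  simp [allocWeight]

end Payments

/-! ### A single item `j`: who can receive it for free -/

section Column

variable {n m : ℕ}

/-- The weight of an allocation without the item `j`. -/
def allocWeightErase (j : Fin m) (v : Profile n m) (a : Allocation n m) : ℝ :=
  ∑ x ∈ Finset.univ.erase j, (a x).elim 0 fun i => v i x

/-- The maximum weight on the items other than `j` of a feasible allocation to the bidders in `A`
in which `j` goes to `o`. -/
def bestWeightErase (M : Matroid (Fin m)) (A : Finset (Fin n)) (j : Fin m) (o : Option (Fin n))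
    (v : Profile n m) : ℝ :=
  ⨆ a : {a : Allocation n m // IsFeasible M A Finset.univ a ∧ a j = o}, allocWeightErase j v a.1

theorem allocWeight_eq (j : Fin m) (v : Profile n m) (a : Allocation n m) :
    allocWeight v a = allocWeightErase j v a + (a j).elim 0 fun i => v i j :=
  (Finset.sum_erase_add _ _ (Finset.mem_univ j)).symm

theorem le_bestWeightErase {M : Matroid (Fin m)} {A : Finset (Fin n)} {j : Fin m}
    (v : Profile n m) {a : Allocation n m} (ha : IsFeasible M A Finset.univ a) :
    allocWeightErase j v a ≤ bestWeightErase M A j (a j) v :=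
  le_ciSup (f := fun b : {b : Allocation n m // IsFeasible M A Finset.univ b ∧ b j = a j} =>
    allocWeightErase j v b.1) (Set.finite_range _).bddAbove ⟨a, ha, rfl⟩

theorem exists_bestWeightErase {M : Matroid (Fin m)} {A : Finset (Fin n)} {j : Fin m}
    {o : Option (Fin n)} (v : Profile n m)
    (ho : ∃ a, IsFeasible M A Finset.univ a ∧ a j = o) :
    ∃ a, IsFeasible M A Finset.univ a ∧ a j = o ∧
      allocWeightErase j v a = bestWeightErase M A j o v := by
  obtain ⟨a₀, ha₀⟩ := ho
  have : Nonempty {a : Allocation n m // IsFeasible M A Finset.univ a ∧ a j = o} := ⟨⟨a₀, ha₀⟩⟩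
  obtain ⟨a, ha⟩ := exists_eq_ciSup_of_finite
    (f := fun a : {a : Allocation n m // IsFeasible M A Finset.univ a ∧ a j = o} =>
      allocWeightErase j v a.1)
  exact ⟨a.1, a.2.1, a.2.2, ha⟩

theorem exists_feasible_some {M : Matroid (Fin m)} {A : Finset (Fin n)} {j : Fin m}
    (hj : M.Indep {j}) {i : Fin n} (hi : i ∈ A) :
    ∃ a : Allocation n m, IsFeasible M A Finset.univ a ∧ a j = some i := by
  refine ⟨fun x => if x = j then some i else none, ⟨fun l => hj.subset fun x hx => ?_,
    fun x l hx => ?_⟩, by simp⟩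
  · simp only [Finset.mem_coe, mem_bundle] at hx
    split_ifs at hx with h
    exact h
  · split_ifs at hx
    exact ⟨(Option.some.inj hx) ▸ hi, Finset.mem_univ x⟩

theorem bestWeight_erase (M : Matroid (Fin m)) (A : Finset (Fin n)) (j : Fin m)
    (v : Profile n m) :
    bestWeight M A (Finset.univ.erase j) v = bestWeightErase M A j none v := by
  refine le_antisymm ?_ ?_
  · obtain ⟨a, ha, hav⟩ := exists_bestWeight M A (Finset.univ.erase j) v
    have hj : a j = none := by
      rcases h : a j with _ | i
      · rfl
      · simpa using (ha.mem j i h).2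
    have := le_bestWeightErase (j := j) v
      (⟨ha.indep, fun x i h => ⟨(ha.mem x i h).1, Finset.mem_univ x⟩⟩ : IsFeasible M A Finset.univ a)
    rw [← hav, allocWeight_eq j, hj] at *
    simpa using this
  · obtain ⟨a, ha, haj, hav⟩ := exists_bestWeightErase (j := j) v
      ⟨_, isFeasible_none M A Finset.univ, rfl⟩
    rw [← hav]
    have := allocWeight_le_bestWeight (S := Finset.univ.erase j) v
      (⟨ha.indep, fun x i h => ⟨(ha.mem x i h).1, by
        refine Finset.mem_erase.2 ⟨?_, Finset.mem_univ x⟩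
        rintro rfl
        rw [haj] at h
        exact Option.some_ne_none i h.symm⟩⟩ : IsFeasible M A (Finset.univ.erase j) a)
    rw [allocWeight_eq j, haj] at this
    simpa using this

theorem bestWeightErase_some_add_le {M : Matroid (Fin m)} {A : Finset (Fin n)} {j : Fin m}
    (hj : M.Indep {j}) {i : Fin n} (hi : i ∈ A) (v : Profile n m) :
    bestWeightErase M A j (some i) v + v i j ≤ bestWeight M A Finset.univ v := by
  obtain ⟨a, ha, haj, hav⟩ := exists_bestWeightErase v (exists_feasible_some hj hi)
  have := allocWeight_le_bestWeight v ha
  rw [allocWeight_eq j, haj, hav] at this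
  simpa using this

theorem bestWeightErase_congr {M : Matroid (Fin m)} {A : Finset (Fin n)} {j : Fin m}
    {o : Option (Fin n)} {v v' : Profile n m} (h : ∀ i, ∀ x ≠ j, v i x = v' i x) :
    bestWeightErase M A j o v = bestWeightErase M A j o v' := by
  refine iSup_congr fun a => Finset.sum_congr rfl fun x hx => ?_
  cases a.1 x with
  | none => rfl
  | some i => exact h i x (Finset.ne_of_mem_erase hx)

/-- The bidders in `A` who can receive `j` on top of an optimal allocation of the other items. -/
def freeBidders (M : Matroid (Fin m)) (A : Finset (Fin n)) (j : Fin m) (v : Profile n m) :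
    Finset (Fin n) :=
  A.filter fun i => bestWeightErase M A j none v ≤ bestWeightErase M A j (some i) v

theorem freeBidders_congr {M : Matroid (Fin m)} {A : Finset (Fin n)} {j : Fin m}
    {v v' : Profile n m} (h : ∀ i, ∀ x ≠ j, v i x = v' i x) :
    freeBidders M A j v = freeBidders M A j v' := by
  simp only [freeBidders, bestWeightErase_congr h]

/-- Fix an optimal allocation of the items other than `j`. A bidder whose bundle does not span `j`
can add `j` to it and is free. The bundles of all others form a disjoint spanning collection of `j`.
-/
theorem card_le_card_freeBidders_add {M : Matroid (Fin m)} (hM : M.E = Set.univ)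
    (A : Finset (Fin n)) {j : Fin m} (hj : M.Indep {j}) (v : Profile n m) :
    A.card ≤ (freeBidders M A j v).card + disjointSpanningNumber M := by
  classical
  obtain ⟨a, ha, haj, hav⟩ := exists_bestWeightErase (j := j) v
    ⟨_, isFeasible_none M A Finset.univ, rfl⟩
  have hjb : ∀ i, j ∉ bundle a i := fun i => by simp [haj]
  have hsp : ∀ i ∈ A \ freeBidders M A j v, Spans M (bundle a i) j := by
    intro i hi
    obtain ⟨hiA, hi⟩ := Finset.mem_sdiff.1 hi
    refine ⟨hjb i, ?_⟩
    by_contra hr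
    have hins : M.Indep (insert j (bundle a i : Set (Fin m))) := by
      rw [(ha.indep i).insert_indep_iff]
      refine Or.inl ⟨by simp [hM], fun hcl => hr ?_⟩
      rw [← M.eRk_closure_eq, Matroid.closure_insert_eq_of_mem_closure hcl, M.eRk_closure_eq]
    refine hi (Finset.mem_filter.2 ⟨hiA, ?_⟩)
    let a' : Allocation n m := Function.update a j (some i)
    have ha' : IsFeasible M A Finset.univ a' := by
      refine ⟨fun l => ?_, fun x l hx => ⟨?_, Finset.mem_univ x⟩⟩
      · rcases eq_or_ne l i with rfl | hli
        · refine hins.subset fun x hx => ?_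
          by_cases hxj : x = j
          · exact Or.inl hxj
          · right
            simpa [a', hxj] using hx
        · refine (ha.indep l).subset fun x hx => ?_
          by_cases hxj : x = j
          · subst hxj
            simp [a', hli.symm] at hx
          · simpa [a', hxj] using hx
      · by_cases hxj : x = j
        · subst hxj
          simp only [a', Function.update_self, Option.some.injEq] at hx
          rwa [← hx]
        · simp only [a', Function.update_of_ne hxj] at hx
          exact (ha.mem x l hx).1
    have h1 := le_bestWeightErase (j := j) v ha'
    have h2 : allocWeightErase j v a' = allocWeightErase j v a :=
      Finset.sum_congr rfl fun x hx => by
        simp only [a', Function.update_of_ne (Finset.ne_of_mem_erase hx)]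
    rw [h2, hav] at h1
    simpa [a'] using h1
  -- Since `j` is not a loop, `∅` does not span it. Disjoint nonempty bundles are distinct, so
  -- counting bundles counts bidders.
  have hne : ∀ i ∈ A \ freeBidders M A j v, (bundle a i).Nonempty := by
    intro i hi
    rw [Finset.nonempty_iff_ne_empty]
    intro he
    have h := (hsp i hi).2
    rw [he] at h
    have h1 : M.eRk {j} = 1 := by rw [hj.eRk_eq_encard]; simp
    simp [h1] at h
  have hdisj : ∀ i l, i ≠ l → Disjoint (bundle a i) (bundle a l) := by
    intro i l hil
    rw [Finset.disjoint_left]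
    intro x hx hx'
    rw [mem_bundle] at hx hx'
    exact hil (Option.some.inj (hx.symm.trans hx'))
  have hinj : Set.InjOn (bundle a) (A \ freeBidders M A j v : Finset (Fin n)) := by
    intro i hi l hl h
    by_contra hil
    have := hdisj i l hil
    rw [← h, disjoint_self] at this
    exact (hne i hi).ne_empty this
  have hcard : ((A \ freeBidders M A j v).image (bundle a)).card ≤ disjointSpanningNumber M := by
    have h1 : IsDisjointSpanningCollection M j ((A \ freeBidders M A j v).image (bundle a)) := by
      refine ⟨fun I hI => ?_, ?_⟩
      · obtain ⟨i, hi, rfl⟩ := Finset.mem_image.1 hI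
        exact ⟨ha.indep i, hsp i hi⟩
      · intro I hI J hJ hIJ
        obtain ⟨i, hi, rfl⟩ := Finset.mem_image.1 (Finset.mem_coe.1 hI)
        obtain ⟨l, hl, rfl⟩ := Finset.mem_image.1 (Finset.mem_coe.1 hJ)
        exact hdisj i l fun h => hIJ (by rw [h])
    refine le_trans ?_ (Finset.le_sup (f := disjointSpanningNumberAt M) (Finset.mem_univ j))
    exact Finset.le_sup (f := Finset.card) (Finset.mem_filter.2 ⟨Finset.mem_univ _, h1⟩)
  rw [Finset.card_image_of_injOn hinj] at hcard
  have h1 := Finset.card_sdiff_add_card_inter A (freeBidders M A j v)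
  have h2 : A ∩ freeBidders M A j v = freeBidders M A j v :=
    Finset.inter_eq_right.2 (Finset.filter_subset _ _)
  rw [h2] at h1
  omega

theorem abs_allocWeightErase_le (j : Fin m) (v : Profile n m) (a : Allocation n m) :
    |allocWeightErase j v a| ≤ ∑ x, ∑ i, |v i x| := by
  refine (Finset.abs_sum_le_sum_abs _ _).trans ?_
  refine (Finset.sum_le_sum fun x _ => ?_).trans (Finset.sum_le_sum_of_subset_of_nonneg
    (Finset.subset_univ _) fun x _ _ => Finset.sum_nonneg fun i _ => abs_nonneg (v i x))
  cases a x with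
  | none => simpa using Finset.sum_nonneg fun i _ => abs_nonneg (v i x)
  | some i =>
    exact Finset.single_le_sum (f := fun i => |v i x|) (fun i _ => abs_nonneg _) (Finset.mem_univ i)

/-- Removing a bidder does not enlarge the set of bidders who can receive `j` for free. -/
theorem freeBidders_erase_subset {M : Matroid (Fin m)} {j : Fin m} (hj : M.Indep {j})
    (v : Profile n m) (i : Fin n) :
    freeBidders M (Finset.univ.erase i) j v ⊆ freeBidders M Finset.univ j v := by
  intro b hb
  obtain ⟨hbA, hb⟩ := Finset.mem_filter.1 hb
  refine Finset.mem_filter.2 ⟨Finset.mem_univ b, ?_⟩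
  have hbi : b ≠ i := Finset.ne_of_mem_erase hbA
  obtain ⟨a, ha, haj, hav⟩ := exists_bestWeightErase (j := j) v
    ⟨_, isFeasible_none M (Finset.univ : Finset (Fin n)) Finset.univ, rfl⟩
  set C := ∑ x, ∑ i, |v i x| with hC
  -- Weights on the items other than `j` lie between `-C` and `C`, so giving `b` the value `H` for
  -- `j`, and everyone else `0`, outweighs any change in the other items.
  let H : ℝ := 2 * C + 1
  let v' : Profile n m := fun l x => if x = j then (if l = b then H else 0) else v l x
  have hvv' : ∀ l, ∀ x ≠ j, v l x = v' l x := fun l x hx => by simp [v', hx]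
  have hD : j ∉ bundle a i := by simp [haj]
  -- Without bidder `i`, the marginal worth of `j` is at least `H` because `b` is free. By
  -- submodularity it stays so after `i`'s bundle is removed. Returning that bundle to `i` gives an
  -- allocation to all bidders that has `j` with `b` and loses nothing on the other items.
  have h1 := bestWeight_union_add_inter_le M (Finset.univ.erase i) (Finset.univ \ bundle a i)
    (Finset.univ.erase j) v'
  have e1 : (Finset.univ \ bundle a i) ∪ Finset.univ.erase j = Finset.univ := by
    ext x
    by_cases hx : x = j
    · subst hx; simpa using hD
    · simp [hx]
  have e2 : (Finset.univ \ bundle a i) ∩ Finset.univ.erase j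
      = Finset.univ \ insert j (bundle a i) := by
    ext x; simp [and_comm]
  rw [e1, e2, bestWeight_erase, ← bestWeightErase_congr hvv'] at h1
  have h2 := bestWeightErase_some_add_le hj hbA v'
  rw [← bestWeightErase_congr hvv', show v' b j = H by simp [v']] at h2
  let a₁ : Allocation n m := fun x => if a x = some i then none else a x
  have ha₁ : IsFeasible M (Finset.univ.erase i) (Finset.univ \ insert j (bundle a i)) a₁ := by
    refine ⟨fun l => (ha.indep l).subset fun x hx => ?_, fun x l hx => ?_⟩
    · simp only [Finset.mem_coe, mem_bundle, a₁] at hx ⊢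
      split_ifs at hx
      exact hx
    · simp only [a₁] at hx
      split_ifs at hx with h
      simp only [Finset.mem_erase, Finset.mem_univ, and_true, Finset.mem_sdiff, mem_bundle, h,
        Finset.mem_insert, true_and, or_false]
      refine ⟨?_, ?_⟩
      · rintro rfl; exact h hx
      · rintro rfl; rw [haj] at hx; exact Option.some_ne_none _ hx.symm
  have h3 := allocWeight_le_bestWeight v' ha₁
  rw [allocWeight_eq j, show a₁ j = none by simp [a₁, haj]] at h3
  have e3 : allocWeightErase j v a = allocWeightErase j v' a₁ + ∑ x ∈ bundle a i, v i x := by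
    rw [allocWeightErase, allocWeightErase, bundle, Finset.sum_filter,
      ← Finset.sum_erase_add Finset.univ (fun x => if a x = some i then v i x else 0)
        (Finset.mem_univ j), if_neg (by simp [haj]), add_zero, ← Finset.sum_add_distrib]
    refine Finset.sum_congr rfl fun x hx => ?_
    have hxj := Finset.ne_of_mem_erase hx
    by_cases h : a x = some i
    · simp [a₁, h]
    · simp only [a₁, h, if_false, add_zero]
      cases a x with
      | none => rfl
      | some l => simp [v', hxj]
  obtain ⟨a₂, ha₂, ha₂v⟩ := exists_bestWeight M (Finset.univ.erase i) (Finset.univ \ bundle a i) v'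
  have hi₂ : ∀ x, a x = some i → a₂ x = none := fun x hx => by
    rcases h : a₂ x with _ | l
    · rfl
    · have := (ha₂.mem x l h).2
      simp [hx] at this
  have hi₂' : ∀ x, a₂ x ≠ some i := fun x hx => by simpa using (ha₂.mem x i hx).1
  let a₃ : Allocation n m := fun x => if a x = some i then some i else a₂ x
  have ha₃ : IsFeasible M Finset.univ Finset.univ a₃ := by
    refine ⟨fun l => ?_, fun x l _ => ⟨Finset.mem_univ l, Finset.mem_univ x⟩⟩
    rcases eq_or_ne l i with rfl | hli
    · refine (ha.indep l).subset fun x hx => ?_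
      simp only [Finset.mem_coe, mem_bundle, a₃] at hx ⊢
      split_ifs at hx with h
      · exact h
      · exact absurd hx (hi₂' x)
    · refine (ha₂.indep l).subset fun x hx => ?_
      simp only [Finset.mem_coe, mem_bundle, a₃] at hx ⊢
      split_ifs at hx with h
      · exact absurd (Option.some.inj hx).symm hli
      · exact hx
  have e4 : allocWeightErase j v a₃ = allocWeightErase j v' a₂ + ∑ x ∈ bundle a i, v i x := by
    rw [allocWeightErase, allocWeightErase, bundle, Finset.sum_filter,
      ← Finset.sum_erase_add Finset.univ (fun x => if a x = some i then v i x else 0)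
        (Finset.mem_univ j), if_neg (by simp [haj]), add_zero, ← Finset.sum_add_distrib]
    refine Finset.sum_congr rfl fun x hx => ?_
    have hxj := Finset.ne_of_mem_erase hx
    by_cases h : a x = some i
    · simp [a₃, h, hi₂ x h]
    · simp only [a₃, h, if_false, add_zero]
      cases a₂ x with
      | none => rfl
      | some l => simp [v', hxj]
  have h4 := le_bestWeightErase (j := j) v ha₃
  have e5 : a₃ j = a₂ j := by simp [a₃, haj]
  rw [allocWeight_eq j] at ha₂v
  have key : H + allocWeightErase j v a ≤ allocWeightErase j v a₃
      + (a₂ j).elim 0 fun l => v' l j := by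
    have : (none : Option (Fin n)).elim 0 (fun l => v' l j) = 0 := rfl
    linarith
  have hbound := abs_le.1 (abs_allocWeightErase_le j v a)
  have hbound₃ := abs_le.1 (abs_allocWeightErase_le j v a₃)
  have hj₂ : a₂ j = some b := by
    by_contra hne
    have : (a₂ j).elim 0 (fun l => v' l j) = 0 := by
      rcases h : a₂ j with _ | l
      · rfl
      · have hlb : l ≠ b := by rintro rfl; exact hne h
        simp [v', hlb]
    simp only [H] at key
    linarith [hbound.1, hbound₃.2]
  rw [e5, hj₂] at h4
  rw [hj₂] at key
  simp only [Option.elim_some, v', if_true] at key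
  linarith

theorem le_marginal_of_mem_freeBidders {M : Matroid (Fin m)} {A : Finset (Fin n)} {j : Fin m}
    (hj : M.Indep {j}) {v : Profile n m} {b : Fin n} (hb : b ∈ freeBidders M A j v) :
    v b j ≤ bestWeight M A Finset.univ v - bestWeight M A (Finset.univ.erase j) v := by
  obtain ⟨hbA, hb⟩ := Finset.mem_filter.1 hb
  have := bestWeightErase_some_add_le hj hbA v
  rw [bestWeight_erase]
  linarith

end Column

/-! ### Second highest of exchangeable values -/

section OrderStatistics

variable {β : Type*}

/-- The largest of the values `w b`, `b ∈ Q` (or `0`). -/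
def maxOver (Q : Finset β) (w : β → ℝ) : ℝ≥0∞ := ⨆ b ∈ Q, ENNReal.ofReal (w b)

/-- The second largest of the values `w b`, `b ∈ N`. -/
def secondMax [DecidableEq β] (N : Finset β) (w : β → ℝ) : ℝ≥0∞ := ⨅ a ∈ N, maxOver (N.erase a) w

theorem maxOver_mono_left {Q Q' : Finset β} (h : Q ⊆ Q') (w : β → ℝ) : maxOver Q w ≤ maxOver Q' w :=
  biSup_mono fun _ hb => h hb

theorem maxOver_mono_right (Q : Finset β) {w w' : β → ℝ} (h : ∀ b, w b ≤ w' b) :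
    maxOver Q w ≤ maxOver Q w' :=
  iSup₂_mono fun b _ => ENNReal.ofReal_le_ofReal (h b)

theorem maxOver_map {γ : Type*} (Q : Finset β) (f : β ↪ γ) (w : γ → ℝ) :
    maxOver (Q.map f) w = maxOver Q (w ∘ f) := by
  simp only [maxOver, ← Finset.sup_eq_iSup, Finset.sup_map]
  rfl

theorem measurable_maxOver (Q : Finset β) : Measurable (maxOver Q) :=
  Measurable.biSup _ Q.countable_toSet fun b _ => (measurable_pi_apply b).ennreal_ofReal

variable [DecidableEq β]

theorem secondMax_le {N : Finset β} {a : β} (ha : a ∈ N) (w : β → ℝ) :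
    secondMax N w ≤ maxOver (N.erase a) w :=
  iInf₂_le a ha

theorem secondMax_mono_right (N : Finset β) {w w' : β → ℝ} (h : ∀ b, w b ≤ w' b) :
    secondMax N w ≤ secondMax N w' :=
  iInf₂_mono fun _ _ => maxOver_mono_right _ h

theorem secondMax_map {γ : Type*} [DecidableEq γ] (N : Finset β) (f : β ↪ γ) (w : γ → ℝ) :
    secondMax (N.map f) w = secondMax N (w ∘ f) := by
  simp only [secondMax, ← maxOver_map, Finset.map_erase, ← Finset.inf_eq_iInf, Finset.inf_map]
  rfl

theorem measurable_secondMax [Countable β] (N : Finset β) : Measurable (secondMax N) :=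
  Measurable.iInf fun _ => Measurable.iInf fun _ => measurable_maxOver _

theorem exists_perm_map_eq [Fintype β] {s t U : Finset β} (hs : s ⊆ U) (ht : t ⊆ U)
    (hst : s.card = t.card) :
    ∃ σ : Equiv.Perm β, s.map σ.toEmbedding = t ∧ ∀ b ∉ U, σ b = b := by
  classical
  have hcard : Fintype.card {x : U // (x : β) ∈ s} = Fintype.card {x : U // (x : β) ∈ t} := by
    have h : ∀ r : Finset β, r ⊆ U → Fintype.card {x : U // (x : β) ∈ r} = r.card := fun r hr => by
      rw [← Fintype.card_coe]
      exact Fintype.card_congr ⟨fun x => ⟨x.1.1, x.2⟩, fun x => ⟨⟨x.1, hr x.2⟩, x.2⟩,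
        fun _ => rfl, fun _ => rfl⟩
    rw [h s hs, h t ht, hst]
  let e : {x : U // (x : β) ∈ s} ≃ {x : U // (x : β) ∈ t} := Fintype.equivOfCardEq hcard
  refine ⟨Equiv.Perm.ofSubtype (e.extendSubtype), ?_, fun b hb =>
    Equiv.Perm.ofSubtype_apply_of_not_mem _ hb⟩
  refine Finset.eq_of_subset_of_card_le (fun x hx => ?_) (by rw [Finset.card_map, hst])
  obtain ⟨y, hy, rfl⟩ := Finset.mem_map.1 hx
  simp only [Equiv.coe_toEmbedding]
  rw [Equiv.Perm.ofSubtype_apply_of_mem _ (hs hy)]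
  exact e.extendSubtype_mem ⟨y, hs hy⟩ hy

/-- The second largest of `k` exchangeable values is at most the expected maximum of `k - 1` other
values, if the latter set of size `k - 1` may only depend on the index of a distinguished value. -/
theorem lintegral_secondMax_le_sum_setLIntegral {Ω : Type*} [MeasurableSpace Ω] {μ : Measure Ω}
    [Fintype β] {w : Ω → β → ℝ} (hw : Measurable w) {T : Equiv.Perm β → Ω → Ω}
    (hT : ∀ σ, MeasurePreserving (T σ) μ μ) (hwT : ∀ σ ω b, w (T σ ω) b = w ω (σ b))
    {A : β → Set Ω} (hA : ∀ i, MeasurableSet (A i)) {B : Finset β} {Q : β → Finset β}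
    (hQ : ∀ i, Q i ⊆ B.erase i) {N : Finset β} (hN : N.Nonempty) (hNB : N.card ≤ B.card)
    (hNQ : ∀ i, N.card ≤ (Q i).card + 1)
    (hinv : ∀ i σ, σ i = i → (∀ b ∉ B, σ b = b) → ∀ ω, T σ ω ∈ A i ↔ ω ∈ A i)
    (hcov : ∀ᵐ ω ∂μ, ∃ i, ω ∈ A i) :
    ∫⁻ ω, secondMax N (w ω) ∂μ ≤ ∑ i, ∫⁻ ω in A i, maxOver (Q i) (w ω) ∂μ := by
  obtain ⟨N', hN'B, hN'⟩ := Finset.exists_subset_card_eq hNB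
  have hwT' : ∀ σ ω, w (T σ ω) = w ω ∘ σ := fun σ ω => funext fun b => hwT σ ω b
  have h1 : ∫⁻ ω, secondMax N (w ω) ∂μ = ∫⁻ ω, secondMax N' (w ω) ∂μ := by
    obtain ⟨σ, hσ, -⟩ := exists_perm_map_eq (Finset.subset_univ N) (Finset.subset_univ N') hN'.symm
    refine ((hT σ).lintegral_comp ((measurable_secondMax N).comp hw)).symm.trans ?_
    simp only [Function.comp_apply, hwT', ← hσ, secondMax_map, Equiv.coe_toEmbedding]
  rw [h1]
  calc ∫⁻ ω, secondMax N' (w ω) ∂μ = ∫⁻ ω in ⋃ i, A i, secondMax N' (w ω) ∂μ := by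
        rw [Measure.restrict_eq_self_of_ae_mem]
        filter_upwards [hcov] with ω hω using Set.mem_iUnion.2 hω
    _ ≤ ∑' i, ∫⁻ ω in A i, secondMax N' (w ω) ∂μ := lintegral_iUnion_le _ _
    _ = ∑ i, ∫⁻ ω in A i, secondMax N' (w ω) ∂μ := tsum_fintype _
    _ ≤ _ := Finset.sum_le_sum fun i _ => ?_
  -- The second maximum is bounded by the maximum after deleting any one element. Deleting `i`, if
  -- present, leaves indices that can be permuted into `Q i` while `i` stays fixed, which preserves
  -- the event `A i`.
  obtain ⟨a, ha, hai⟩ : ∃ a ∈ N', i ∉ N'.erase a := by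
    by_cases hi : i ∈ N'
    · exact ⟨i, hi, by simp⟩
    · obtain ⟨a, ha⟩ := Finset.card_pos.1 (hN' ▸ hN.card_pos)
      exact ⟨a, ha, fun h => hi (Finset.mem_of_mem_erase h)⟩
  have hcard : (N'.erase a).card ≤ (Q i).card := by
    rw [Finset.card_erase_of_mem ha, hN']
    have := hNQ i
    omega
  obtain ⟨Q', hQ'Q, hQ'⟩ := Finset.exists_subset_card_eq hcard
  obtain ⟨σ, hσ, hσB⟩ := exists_perm_map_eq (U := B.erase i) (hQ'Q.trans (hQ i))
    (t := N'.erase a) (fun x hx => Finset.mem_erase.2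
      ⟨fun h => hai (h ▸ hx), hN'B (Finset.mem_of_mem_erase hx)⟩) hQ'
  have hσA : ∀ ω, T σ ω ∈ A i ↔ ω ∈ A i :=
    hinv i σ (hσB i (by simp)) fun b hb => hσB b fun h => hb (Finset.mem_of_mem_erase h)
  calc ∫⁻ ω in A i, secondMax N' (w ω) ∂μ ≤ ∫⁻ ω in A i, maxOver (N'.erase a) (w ω) ∂μ :=
        lintegral_mono fun ω => secondMax_le ha _
    _ = ∫⁻ ω in A i, maxOver Q' (w ω) ∂μ := by
        rw [← lintegral_indicator (hA i), ← lintegral_indicator (hA i)]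
        refine Eq.trans ?_
          ((hT σ).lintegral_comp (((measurable_maxOver Q').comp hw).indicator (hA i)))
        refine lintegral_congr fun ω => ?_
        by_cases h : ω ∈ A i
        · rw [Set.indicator_of_mem h, Set.indicator_of_mem ((hσA ω).2 h)]
          rw [hwT',
            ← hσ, maxOver_map, Equiv.coe_toEmbedding]
        · rw [Set.indicator_of_notMem h, Set.indicator_of_notMem (mt (hσA ω).1 h)]
    _ ≤ _ := lintegral_mono fun ω => maxOver_mono_left hQ'Q _

end OrderStatistics

/-! ### Winners of an item and the pointwise and expected revenue bounds -/

section Winners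

variable {n m : ℕ}

/-- The values for which bidder `i` strictly wins item `j`. -/
def winEvent (M : Matroid (Fin m)) (j : Fin m) (i : Fin n) : Set (Profile n m) :=
  {v | ∀ b ≠ i, v b j + bestWeightErase M Finset.univ j (some b) v
    < v i j + bestWeightErase M Finset.univ j (some i) v}

theorem bestWeight_erase_le (M : Matroid (Fin m)) (A : Finset (Fin n)) (j : Fin m)
    (v : Profile n m) : bestWeight M A (Finset.univ.erase j) v ≤ bestWeight M A Finset.univ v := by
  obtain ⟨a, ha, hav⟩ := exists_bestWeight M A (Finset.univ.erase j) v
  rw [← hav]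
  exact allocWeight_le_bestWeight v ⟨ha.indep, fun x i h => ⟨(ha.mem x i h).1, Finset.mem_univ x⟩⟩

/-- If an optimal allocation gives `j` to `i₀`, no other bidder can strictly win `j`, and the free
bidders without `i₀` bound the marginal worth of `j` from below. -/
theorem sum_indicator_winEvent_le (M : Matroid (Fin m)) (v : Profile n m) {L : Finset (Fin m)}
    (hL : ∀ j ∈ L, M.Indep {j}) :
    ∑ j ∈ L, ∑ i, (winEvent M j i).indicator
        (fun v => maxOver (freeBidders M (Finset.univ.erase i) j v) fun b => v b j) v
      ≤ ENNReal.ofReal (∑ i, vcgPayment (matroidConstraint M) v i) := by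
  obtain ⟨a, ha, hav⟩ := exists_bestWeight M (Finset.univ : Finset (Fin n)) Finset.univ v
  refine le_trans ?_ (ENNReal.ofReal_le_ofReal (sum_marginal_le_sum_vcgPayment ha hav))
  have hnn : ∀ j, 0 ≤ (a j).elim 0 (fun i => bestWeight M (Finset.univ.erase i) Finset.univ v
        - bestWeight M (Finset.univ.erase i) (Finset.univ.erase j) v) := fun j => by
    rcases a j with _ | i
    · exact le_rfl
    · exact sub_nonneg.2 (bestWeight_erase_le M _ j v)
  rw [ENNReal.ofReal_sum_of_nonneg fun j _ => hnn j]
  refine le_trans (Finset.sum_le_sum fun j hj => ?_)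
    (Finset.sum_le_sum_of_subset (Finset.subset_univ L))
  have hle := le_bestWeightErase (j := j) v ha
  rw [allocWeight_eq j] at hav
  rcases haj : a j with _ | i₀
  -- If an optimal allocation leaves `j` unassigned, `j` has no positive marginal worth. So no free
  -- bidder has a positive value for it, and the maximum is `0`.
  · refine le_of_eq_of_le (Finset.sum_eq_zero fun i _ => ?_) zero_le
    refine Set.indicator_apply_eq_zero.2 fun _ => ?_
    simp only [maxOver, ENNReal.iSup_eq_zero, ENNReal.ofReal_eq_zero]
    intro b hb
    have h1 := le_marginal_of_mem_freeBidders (hL j hj) (freeBidders_erase_subset (hL j hj) v i hb)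
    rw [bestWeight_erase] at h1
    rw [haj] at hle hav
    simp only [Option.elim_none] at hav
    linarith
  · rw [Finset.sum_eq_single i₀]
    · refine (Set.indicator_le_self' (fun _ _ => zero_le) v).trans ?_
      exact iSup₂_le fun b hb => ENNReal.ofReal_le_ofReal (le_marginal_of_mem_freeBidders (hL j hj) hb)
    · intro i _ hi
      refine Set.indicator_of_notMem (fun hv => ?_) _
      have h1 := hv i₀ hi.symm
      have h2 := bestWeightErase_some_add_le (hL j hj) (Finset.mem_univ i) v
      rw [haj] at hle hav
      simp only [Option.elim_some] at hav
      linarith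
    · simp

theorem measurable_allocWeightErase (j : Fin m) (a : Allocation n m) :
    Measurable fun v : Profile n m => allocWeightErase j v a := by
  refine Finset.measurable_fun_sum _ fun x _ => ?_
  rcases a x with _ | i
  · exact measurable_const
  · exact (measurable_pi_apply x).comp (measurable_pi_apply i)

theorem measurable_bestWeightErase (M : Matroid (Fin m)) (A : Finset (Fin n)) (j : Fin m)
    (o : Option (Fin n)) : Measurable (bestWeightErase M A j o) :=
  Measurable.iSup fun a => measurable_allocWeightErase j a.1

theorem measurable_entry (i : Fin n) (j : Fin m) : Measurable fun v : Profile n m => v i j :=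
  (measurable_pi_apply j).comp (measurable_pi_apply i)

theorem measurable_column (j : Fin m) : Measurable fun (v : Profile n m) b => v b j :=
  measurable_pi_lambda _ fun b => measurable_entry b j

theorem measurableSet_winEvent (M : Matroid (Fin m)) (j : Fin m) (i : Fin n) :
    MeasurableSet (winEvent M j i) := by
  simp only [winEvent, Set.ofPred_forall]
  exact MeasurableSet.iInter fun b => MeasurableSet.iInter fun _ => measurableSet_lt
    ((measurable_entry b j).add (measurable_bestWeightErase M _ j _))
    ((measurable_entry i j).add (measurable_bestWeightErase M _ j _))

theorem measurableSet_mem_freeBidders (M : Matroid (Fin m)) (A : Finset (Fin n)) (j : Fin m)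
    (b : Fin n) : MeasurableSet {v : Profile n m | b ∈ freeBidders M A j v} := by
  by_cases hA : b ∈ A
  · simpa [freeBidders, hA] using
      measurableSet_le (measurable_bestWeightErase M A j none)
        (measurable_bestWeightErase M A j (some b))
  · simp [freeBidders, hA]

theorem measurableSet_freeBidders_eq (M : Matroid (Fin m)) (A : Finset (Fin n)) (j : Fin m)
    (B : Finset (Fin n)) : MeasurableSet {v | freeBidders M A j v = B} := by
  have : {v | freeBidders M A j v = B} = ⋂ b, {v : Profile n m | b ∈ freeBidders M A j v ↔ b ∈ B} := by
    ext v; simp [Finset.ext_iff]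
  rw [this]
  refine MeasurableSet.iInter fun b => ?_
  have hb := measurableSet_mem_freeBidders M A j b
  by_cases hB : b ∈ B
  · simpa [hB] using hb
  · simp only [hB, iff_false]
    exact hb.compl

theorem measurable_maxOver_freeBidders (M : Matroid (Fin m)) (A : Finset (Fin n)) (j : Fin m) :
    Measurable fun v : Profile n m => maxOver (freeBidders M A j v) fun b => v b j := by
  have : (fun v : Profile n m => maxOver (freeBidders M A j v) fun b => v b j)
      = fun v => ⨆ b, {v | b ∈ freeBidders M A j v}.indicator (fun v => ENNReal.ofReal (v b j)) v := by
    ext v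
    refine iSup_congr fun b => ?_
    by_cases hb : b ∈ freeBidders M A j v <;> simp [hb]
  rw [this]
  exact Measurable.iSup fun b => (measurable_entry b j).ennreal_ofReal.indicator
    (measurableSet_mem_freeBidders M A j b)

/-- Permuting the bidders' values for item `j`. -/
def permColumn (j : Fin m) (σ : Equiv.Perm (Fin n)) (v : Profile n m) : Profile n m :=
  fun b x => if x = j then v (σ b) j else v b x

theorem permColumn_apply_of_ne {j x : Fin m} (hx : x ≠ j) (σ : Equiv.Perm (Fin n))
    (v : Profile n m) (b : Fin n) : permColumn j σ v b x = v b x := if_neg hx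

theorem permColumn_apply_self (j : Fin m) (σ : Equiv.Perm (Fin n))
    (v : Profile n m) (b : Fin n) : permColumn j σ v b j = v (σ b) j := if_pos rfl

theorem bestWeightErase_some_eq_of_mem {M : Matroid (Fin m)} {A : Finset (Fin n)} {j : Fin m}
    (hj : M.Indep {j}) {v : Profile n m} {b : Fin n} (hb : b ∈ freeBidders M A j v) :
    bestWeightErase M A j (some b) v = bestWeightErase M A j none v := by
  obtain ⟨hbA, hb⟩ := Finset.mem_filter.1 hb
  refine le_antisymm ?_ hb
  obtain ⟨a, ha, haj, hav⟩ := exists_bestWeightErase v (exists_feasible_some hj hbA)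
  have ha' : IsFeasible M A Finset.univ (Function.update a j none) := by
    refine ⟨fun l => (ha.indep l).subset fun x hx => ?_, fun x l hx => ⟨?_, Finset.mem_univ x⟩⟩
    · by_cases hxj : x = j
      · subst hxj; simp at hx
      · simpa [hxj] using hx
    · by_cases hxj : x = j
      · subst hxj; simp at hx
      · exact (ha.mem x l (by simpa [hxj] using hx)).1
  have := le_bestWeightErase (j := j) v ha'
  rw [Function.update_self] at this
  rw [← hav]
  refine le_of_eq_of_le (Finset.sum_congr rfl fun x hx => ?_) this
  rw [Function.update_of_ne (Finset.ne_of_mem_erase hx)]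

/-- All free bidders have the same optimal weight on the other items when they receive `j`.
Permuting their values for `j` thus permutes their scores, and the score of `i` is unchanged. -/
theorem permColumn_mem_winEvent {M : Matroid (Fin m)} {j : Fin m} (hj : M.Indep {j})
    {i : Fin n} {σ : Equiv.Perm (Fin n)} (hσi : σ i = i) {v : Profile n m}
    (hσ : ∀ b ∉ freeBidders M Finset.univ j v, σ b = b) :
    permColumn j σ v ∈ winEvent M j i ↔ v ∈ winEvent M j i := by
  have hc : ∀ o, bestWeightErase M Finset.univ j o (permColumn j σ v)
      = bestWeightErase M Finset.univ j o v := fun o =>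
    bestWeightErase_congr fun b x hx => permColumn_apply_of_ne hx σ v b
  have hκ : ∀ b, bestWeightErase M Finset.univ j (some (σ b)) v
      = bestWeightErase M Finset.univ j (some b) v := fun b => by
    by_cases hb : b ∈ freeBidders M Finset.univ j v
    · have hσb : σ b ∈ freeBidders M Finset.univ j v := by
        by_contra h
        have := σ.injective (hσ _ h)
        rw [this] at h
        exact h hb
      rw [bestWeightErase_some_eq_of_mem hj hb, bestWeightErase_some_eq_of_mem hj hσb]
    · rw [hσ b hb]
  simp only [winEvent, Set.mem_ofPred_eq, hc, permColumn_apply_self, hσi]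
  constructor
  · intro h b hb
    have := h (σ.symm b) fun h' => hb (by rw [← hσi, ← h', σ.apply_symm_apply])
    rwa [σ.apply_symm_apply, ← hκ, σ.apply_symm_apply] at this
  · intro h b hb
    rw [← hκ b]
    exact h (σ b) fun h' => hb (σ.injective (h'.trans hσi.symm))

/-- For exchangeable values without ties, VCG earns in expectation at least the sum of the second
largest of `k` values for every item that is not a loop. -/
theorem sum_lintegral_secondMax_le {M : Matroid (Fin m)} (hM : M.E = Set.univ)
    {μ : Measure (Profile n m)}
    (hperm : ∀ j σ, MeasurePreserving (permColumn j σ) μ μ) {L : Finset (Fin m)}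
    (hL : ∀ j ∈ L, M.Indep {j}) (hwin : ∀ j ∈ L, ∀ᵐ v ∂μ, ∃ i, v ∈ winEvent M j i)
    {N : Finset (Fin n)} (hN : N.Nonempty) (hNn : N.card + disjointSpanningNumber M ≤ n) :
    ∑ j ∈ L, ∫⁻ v, secondMax N (fun b => v b j) ∂μ
      ≤ ∫⁻ v, ENNReal.ofReal (∑ i, vcgPayment (matroidConstraint M) v i) ∂μ := by
  -- All the sets of free bidders, with everybody present and with each bidder removed. They take
  -- finitely many values and ignore the values for `j`, so the law restricted to a fiber of `D j`
  -- is still invariant under `permColumn j`.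
  let D : Fin m → Profile n m → Finset (Fin n) × (Fin n → Finset (Fin n)) := fun j v =>
    (freeBidders M Finset.univ j v, fun i => freeBidders M (Finset.univ.erase i) j v)
  have hDm : ∀ j d, MeasurableSet (D j ⁻¹' {d}) := fun j d => by
    have : D j ⁻¹' {d} = {v | freeBidders M Finset.univ j v = d.1}
        ∩ ⋂ i, {v | freeBidders M (Finset.univ.erase i) j v = d.2 i} := by
      ext v; simp [D, Prod.ext_iff, funext_iff]
    rw [this]
    exact (measurableSet_freeBidders_eq M _ j _).inter
      (MeasurableSet.iInter fun i => measurableSet_freeBidders_eq M _ j _)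
  have hDi : ∀ j σ v, D j (permColumn j σ v) = D j v := fun j σ v => by
    have : ∀ A, freeBidders M A j (permColumn j σ v) = freeBidders M A j v := fun A =>
      freeBidders_congr fun b x hx => permColumn_apply_of_ne hx σ v b
    simp only [D, this]
  have hsplit : ∀ j (f : Profile n m → ℝ≥0∞),
      ∫⁻ v, f v ∂μ = ∑ d, ∫⁻ v in D j ⁻¹' {d}, f v ∂μ := fun j f => by
    rw [← tsum_fintype (L := .unconditional _), ← lintegral_iUnion (hDm j)
      (fun d d' hdd' => Disjoint.preimage _ (by simpa using hdd'))]
    rw [← Set.preimage_iUnion, Set.iUnion_of_singleton, Set.preimage_univ, Measure.restrict_univ]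
  have hg : ∀ (j : Fin m) (i : Fin n), Measurable ((winEvent M j i).indicator
      fun v => maxOver (freeBidders M (Finset.univ.erase i) j v) fun b => v b j) := fun j i =>
    (measurable_maxOver_freeBidders M _ j).indicator (measurableSet_winEvent M j i)
  have hcol : ∀ j ∈ L, ∫⁻ v, secondMax N (fun b => v b j) ∂μ
      ≤ ∫⁻ v, ∑ i, (winEvent M j i).indicator
        (fun v => maxOver (freeBidders M (Finset.univ.erase i) j v) fun b => v b j) v ∂μ := by
    intro j hj
    rw [hsplit j, hsplit j]
    refine Finset.sum_le_sum fun d _ => ?_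
    rcases (D j ⁻¹' {d}).eq_empty_or_nonempty with he | ⟨v₀, hv₀⟩
    · simp [he]
    have hd : D j v₀ = d := hv₀
    have key := lintegral_secondMax_le_sum_setLIntegral (μ := μ.restrict (D j ⁻¹' {d}))
      (w := fun v b => v b j) (measurable_column j) (T := permColumn j)
      (fun σ => by
        have := (hperm j σ).restrict_preimage (hDm j d)
        have h2 : permColumn j σ ⁻¹' (D j ⁻¹' {d}) = D j ⁻¹' {d} := by
          ext v; simp [hDi]
        rwa [h2] at this)
      (fun σ v b => permColumn_apply_self j σ v b)
      (A := fun i => winEvent M j i ∩ D j ⁻¹' {d})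
      (fun i => (measurableSet_winEvent M j i).inter (hDm j d))
      (B := d.1) (Q := d.2)
      (fun i b hb => by
        rw [← hd] at hb ⊢
        exact Finset.mem_erase.2 ⟨Finset.ne_of_mem_erase (Finset.mem_filter.1 hb).1,
          freeBidders_erase_subset (hL j hj) v₀ i hb⟩)
      hN
      (by
        rw [← hd]
        have := card_le_card_freeBidders_add hM Finset.univ (hL j hj) v₀
        rw [Finset.card_univ, Fintype.card_fin] at this
        simp only [D]
        omega)
      (fun i => by
        rw [← hd]
        have := card_le_card_freeBidders_add hM (Finset.univ.erase i) (hL j hj) v₀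
        rw [Finset.card_erase_of_mem (Finset.mem_univ i), Finset.card_univ, Fintype.card_fin] at this
        simp only [D]
        omega)
      (fun i σ hσi hσ v => by
        simp only [Set.mem_inter_iff, Set.mem_preimage, hDi, Set.mem_singleton_iff]
        refine and_congr_left fun hv => permColumn_mem_winEvent (hL j hj) hσi fun b hb => hσ b ?_
        rwa [← hv])
      (by
        rw [ae_restrict_iff' (hDm j d)]
        filter_upwards [hwin j hj] with v ⟨i, hi⟩ hv using ⟨i, hi, hv⟩)
    refine key.trans ?_
    rw [lintegral_finsetSum _ fun i _ => hg j i]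
    refine Finset.sum_le_sum fun i _ => ?_
    rw [lintegral_indicator (measurableSet_winEvent M j i), Measure.restrict_restrict
      (measurableSet_winEvent M j i), Measure.restrict_restrict ((measurableSet_winEvent M j i).inter
      (hDm j d)), Set.inter_assoc, Set.inter_self]
    refine setLIntegral_mono' ((measurableSet_winEvent M j i).inter (hDm j d)) fun v hv => ?_
    have : D j v = d := hv.2
    rw [← this]
  refine (Finset.sum_le_sum hcol).trans ?_
  rw [← lintegral_finsetSum _ fun j _ => Finset.measurable_fun_sum _ fun i _ => hg j i]
  exact lintegral_mono fun v => sum_indicator_winEvent_le M v hL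

end Winners

/-! ### Symmetries and resampling of the law of the value profile -/

section ProfileLaw

variable {n m : ℕ}

theorem profileLaw_box (F : Fin m → Measure ℝ) [∀ x, IsProbabilityMeasure (F x)]
    (s : Fin n → Fin m → Set ℝ) :
    profileLaw n F {v | ∀ i x, v i x ∈ s i x} = ∏ i, ∏ x, F x (s i x) := by
  have : {v : Profile n m | ∀ i x, v i x ∈ s i x}
      = Set.univ.pi fun i => Set.univ.pi fun x => s i x := by
    ext v; simp
  rw [this, profileLaw, Measure.pi_pi]
  simp only [Measure.pi_pi]

/-- Uncurrying turns the iterated product into one product over pairs, which is determined by its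
boxes. -/
theorem eq_profileLaw {F : Fin m → Measure ℝ} [∀ x, IsProbabilityMeasure (F x)]
    {ν : Measure (Profile n m)}
    (h : ∀ s : Fin n → Fin m → Set ℝ, (∀ i x, MeasurableSet (s i x)) →
      ν {v | ∀ i x, v i x ∈ s i x} = ∏ i, ∏ x, F x (s i x)) : ν = profileLaw n F := by
  let e : Profile n m ≃ᵐ (Fin n × Fin m → ℝ) := (MeasurableEquiv.curry (Fin n) (Fin m) ℝ).symm
  have key : ∀ ν' : Measure (Profile n m),
      (∀ s : Fin n → Fin m → Set ℝ, (∀ i x, MeasurableSet (s i x)) →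
        ν' {v | ∀ i x, v i x ∈ s i x} = ∏ i, ∏ x, F x (s i x)) →
      Measure.pi (fun q : Fin n × Fin m => F q.2) = ν'.map e := by
    intro ν' h'
    refine Measure.pi_eq fun s hs => ?_
    rw [e.map_apply, Fintype.prod_prod_type]
    refine Eq.trans ?_ (h' (fun i x => s (i, x)) fun i x => hs _)
    congr 1
    ext v
    simp [e, MeasurableEquiv.curry, Equiv.curry, Function.uncurry]
  have h1 := (key ν h).symm.trans (key (profileLaw n F) fun s _ => profileLaw_box F s)
  exact e.map_measurableEquiv_injective h1

theorem measurable_permColumn (j : Fin m) (σ : Equiv.Perm (Fin n)) :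
    Measurable (permColumn j σ) := by
  refine measurable_pi_lambda _ fun b => measurable_pi_lambda _ fun x => ?_
  by_cases hx : x = j
  · simp only [permColumn, hx, if_true]; exact measurable_entry _ _
  · simp only [permColumn, hx, if_false]; exact measurable_entry _ _

theorem measurable_update_entry (i : Fin n) (j : Fin m) :
    Measurable fun q : Profile n m × ℝ =>
      Function.update q.1 i (Function.update (q.1 i) j q.2) := by
  have h : ∀ b x, Measurable fun q : Profile n m × ℝ => q.1 b x := fun b x =>
    (measurable_entry b x).comp measurable_fst
  refine measurable_pi_lambda _ fun b => measurable_pi_lambda _ fun x => ?_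
  by_cases hb : b = i
  · subst hb
    by_cases hx : x = j
    · subst hx
      simpa using measurable_snd
    · simpa [hx] using h b x
  · simpa [hb] using h b x

variable {F : Fin m → Measure ℝ} [∀ x, IsProbabilityMeasure (F x)]

instance : IsProbabilityMeasure (profileLaw n F) := by
  unfold profileLaw; infer_instance

theorem measurePreserving_permColumn (j : Fin m) (σ : Equiv.Perm (Fin n)) :
    MeasurePreserving (permColumn j σ) (profileLaw n F) (profileLaw n F) := by
  refine ⟨measurable_permColumn j σ, eq_profileLaw fun s hs => ?_⟩
  rw [Measure.map_apply (measurable_permColumn j σ) (by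
    simp only [Set.ofPred_forall]
    exact MeasurableSet.iInter fun i => MeasurableSet.iInter fun x => measurable_entry i x (hs i x))]
  have : permColumn j σ ⁻¹' {v | ∀ i x, v i x ∈ s i x}
      = {v | ∀ i x, v i x ∈ if x = j then s (σ.symm i) x else s i x} := by
    ext v
    simp only [Set.mem_preimage, Set.mem_ofPred_eq]
    constructor
    · intro h i x
      split_ifs with hx
      · subst hx
        have := h (σ.symm i) x
        rwa [permColumn_apply_self, σ.apply_symm_apply] at this
      · simpa [permColumn_apply_of_ne hx] using h i x
    · intro h i x
      by_cases hx : x = j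
      · subst hx
        rw [permColumn_apply_self]
        simpa using h (σ i) x
      · rw [permColumn_apply_of_ne hx]
        simpa [hx] using h i x
  rw [this, profileLaw_box, Finset.prod_comm, Finset.prod_comm (f := fun i x => F x (s i x))]
  refine Finset.prod_congr rfl fun x _ => ?_
  by_cases hx : x = j
  · simp only [hx, if_true]
    exact Equiv.prod_comp σ.symm fun i => F j (s i j)
  · simp only [hx, if_false]

theorem map_comp_profileLaw {k : ℕ} (f : Fin k ↪ Fin n) :
    (profileLaw n F).map (fun v i => v (f i)) = profileLaw k F := by
  classical
  refine eq_profileLaw fun s hs => ?_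
  have hm : Measurable fun (v : Profile n m) i => v (f i) :=
    measurable_pi_lambda _ fun i => measurable_pi_apply _
  rw [Measure.map_apply hm (by
    simp only [Set.ofPred_forall]
    exact MeasurableSet.iInter fun i => MeasurableSet.iInter fun x => measurable_entry i x (hs i x))]
  let s' : Fin n → Fin m → Set ℝ := fun i x =>
    if h : ∃ b, f b = i then s h.choose x else Set.univ
  have hs' : ∀ b x, s' (f b) x = s b x := fun b x => by
    have h : ∃ b', f b' = f b := ⟨b, rfl⟩
    simp only [s', dif_pos h]
    rw [f.injective h.choose_spec]
  have : (fun (v : Profile n m) i => v (f i)) ⁻¹' {v | ∀ i x, v i x ∈ s i x}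
      = {v | ∀ i x, v i x ∈ s' i x} := by
    ext v
    simp only [Set.mem_preimage, Set.mem_ofPred_eq]
    constructor
    · intro h i x
      by_cases hi : ∃ b, f b = i
      · obtain ⟨b, rfl⟩ := hi
        rw [hs']
        exact h b x
      · simp [s', dif_neg hi]
    · intro h i x
      rw [← hs']
      exact h (f i) x
  rw [this, profileLaw_box]
  refine (Fintype.prod_of_injective f f.injective _ _ (fun i hi => ?_) fun b => ?_).symm
  · have hi' : ¬ ∃ b, f b = i := fun ⟨b, hb⟩ => hi ⟨b, hb⟩
    simp [s', dif_neg hi']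
  · simp only [hs']

theorem map_map_profileLaw {τ : Fin m → ℝ → ℝ} (hτ : ∀ x, Measurable (τ x)) :
    (profileLaw n F).map (fun v i x => τ x (v i x)) = profileLaw n fun x => (F x).map (τ x) := by
  have : ∀ x, IsProbabilityMeasure ((F x).map (τ x)) := fun x =>
    Measure.isProbabilityMeasure_map (hτ x).aemeasurable
  refine eq_profileLaw fun s hs => ?_
  have hm : Measurable fun (v : Profile n m) i x => τ x (v i x) :=
    measurable_pi_lambda _ fun i => measurable_pi_lambda _ fun x => (hτ x).comp (measurable_entry i x)
  rw [Measure.map_apply hm (by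
    simp only [Set.ofPred_forall]
    exact MeasurableSet.iInter fun i => MeasurableSet.iInter fun x => measurable_entry i x (hs i x))]
  refine (profileLaw_box F fun i x => τ x ⁻¹' s i x).trans ?_
  simp only [Measure.map_apply (hτ _) (hs _ _)]

theorem ae_profileLaw {S : Fin m → Set ℝ} (hS : ∀ x, ∀ᵐ t ∂F x, t ∈ S x) :
    ∀ᵐ v ∂profileLaw n F, ∀ i x, v i x ∈ S x := by
  refine ae_all_iff.2 fun i => ae_all_iff.2 fun x => ?_
  have h1 : MeasurePreserving (fun v : Profile n m => v i x) (profileLaw n F) (F x) :=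
    (measurePreserving_eval F x).comp (measurePreserving_eval (fun _ : Fin n => Measure.pi F) i)
  exact h1.quasiMeasurePreserving.ae (hS x)

theorem map_update_profileLaw (i : Fin n) (j : Fin m) :
    ((profileLaw n F).prod (F j)).map
      (fun q => Function.update q.1 i (Function.update (q.1 i) j q.2)) = profileLaw n F := by
  have hm := measurable_update_entry i j
  refine eq_profileLaw fun s hs => ?_
  rw [Measure.map_apply hm (by
    simp only [Set.ofPred_forall]
    exact MeasurableSet.iInter fun i => MeasurableSet.iInter fun x => measurable_entry i x (hs i x))]
  have : (fun q : Profile n m × ℝ => Function.update q.1 i (Function.update (q.1 i) j q.2)) ⁻¹'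
      {v | ∀ i x, v i x ∈ s i x}
      = {v | ∀ b x, v b x ∈ if b = i ∧ x = j then Set.univ else s b x} ×ˢ s i j := by
    ext ⟨v, t⟩
    simp only [Set.mem_preimage, Set.mem_ofPred_eq, Set.mem_prod]
    constructor
    · intro h
      refine ⟨fun b x => ?_, by simpa using h i j⟩
      split_ifs with hbx
      · trivial
      · have := h b x
        by_cases hb : b = i
        · subst hb
          have hx : x ≠ j := fun hx => hbx ⟨rfl, hx⟩
          simpa [hx] using this
        · simpa [hb] using this
    · rintro ⟨h, ht⟩ b x
      have := h b x
      by_cases hb : b = i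
      · subst hb
        by_cases hx : x = j
        · subst hx; simpa using ht
        · simpa [hx] using this
      · simpa [hb] using this
  rw [this, Measure.prod_prod, profileLaw_box, ← Fintype.prod_prod_type',
    ← Fintype.prod_prod_type' (f := fun i x => F x (s i x)),
    ← Finset.prod_erase_mul _ _ (Finset.mem_univ (i, j)),
    ← Finset.prod_erase_mul _ (fun q : Fin n × Fin m => F q.2 (s q.1 q.2))
      (Finset.mem_univ (i, j))]
  simp only [and_self, if_true, measure_univ, mul_one]
  congr 1
  refine Finset.prod_congr rfl fun q hq => ?_
  rw [if_neg fun h => Finset.ne_of_mem_erase hq (Prod.ext h.1 h.2)]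

/-- Resample the entry independently: given the rest of the profile, it would have to hit the fixed
number `h v`. -/
theorem profileLaw_entry_eq_null {i : Fin n} {j : Fin m} (hF : ∀ t, F j {t} = 0)
    {h : Profile n m → ℝ} (hh : Measurable h)
    (hu : ∀ v t, h (Function.update v i (Function.update (v i) j t)) = h v) :
    profileLaw n F {v | v i j = h v} = 0 := by
  have hm := measurable_update_entry i j
  have hs := measurableSet_eq_fun (measurable_entry i j) hh
  rw [← map_update_profileLaw i j, Measure.map_apply hm hs, Measure.measure_prod_null (hm hs)]
  refine Filter.Eventually.of_forall fun v => ?_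
  refine measure_mono_null (fun t ht => ?_) (hF (h v))
  simpa [hu] using ht

end ProfileLaw

/-! ### Revenue of additive VCG, tie-breaking noise, and the comparison with matroid VCG -/

section Revenue

variable {n m : ℕ}

theorem matroidConstraint_freeOn (m : ℕ) :
    matroidConstraint (Matroid.freeOn (Set.univ : Set (Fin m))) = unconstrained m := by
  ext I; simp [matroidConstraint, unconstrained]

/-- For each item, an optimal allocation without its top bidder yields at most the second highest
value, and one without any other bidder at most the highest. The `n - 1` highest values cancel
against `n - 1` times the optimal welfare. -/
theorem sum_vcgPayment_unconstrained_le [NeZero n] {v : Profile n m} (hv : ∀ i j, 0 ≤ v i j) :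
    ENNReal.ofReal (∑ i, vcgPayment (unconstrained m) v i)
      ≤ ∑ j, secondMax Finset.univ fun i => v i j := by
  rw [← matroidConstraint_freeOn, sum_vcgPayment]
  set M := Matroid.freeOn (Set.univ : Set (Fin m)) with hM
  have hfeas : ∀ a : Allocation n m, IsFeasible M Finset.univ Finset.univ a := fun a =>
    ⟨fun i => by simp [hM], fun x i _ => by simp⟩
  choose top htop using fun j => Finite.exists_max fun i => v i j
  choose a ha hav using fun i => exists_bestWeight M (Finset.univ.erase i) Finset.univ v
  let t : Fin n → Fin m → ℝ := fun i j => (a i j).elim 0 fun b => v b j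
  have ht0 : ∀ i j, 0 ≤ t i j := fun i j => by
    simp only [t]
    rcases a i j with _ | b
    · exact le_rfl
    · exact hv b j
  have htle : ∀ i j, t i j ≤ v (top j) j := fun i j => by
    simp only [t]
    rcases a i j with _ | b
    · exact hv _ _
    · exact htop j b
  have hW : ∑ j, v (top j) j ≤ bestWeight M Finset.univ Finset.univ v :=
    allocWeight_le_bestWeight v (hfeas fun j => some (top j))
  have hn : (1 : ℝ) ≤ n := by exact_mod_cast NeZero.one_le
  have hcol : ∀ j, ∑ i, t i j ≤ t (top j) j + (n - 1) * v (top j) j := fun j => by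
    rw [← Finset.add_sum_erase _ _ (Finset.mem_univ (top j))]
    refine add_le_add_right ((Finset.sum_le_card_nsmul _ _ _ fun i _ => htle i j).trans_eq ?_) _
    rw [Finset.card_erase_of_mem (Finset.mem_univ _), Finset.card_univ, Fintype.card_fin,
      nsmul_eq_mul, Nat.cast_sub NeZero.one_le, Nat.cast_one]
  have h1 : ∑ i, bestWeight M (Finset.univ.erase i) Finset.univ v = ∑ j, ∑ i, t i j := by
    rw [Finset.sum_comm]
    exact Finset.sum_congr rfl fun i _ => (hav i).symm
  have h2 : ∑ i, bestWeight M (Finset.univ.erase i) Finset.univ v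
      - (n * bestWeight M Finset.univ Finset.univ v - bestWeight M Finset.univ Finset.univ v)
      ≤ ∑ j, t (top j) j := by
    have h3 := Finset.sum_le_sum fun j (_ : j ∈ Finset.univ) => hcol j
    rw [Finset.sum_add_distrib, ← Finset.mul_sum] at h3
    have h4 := mul_le_mul_of_nonneg_left hW (sub_nonneg.2 hn)
    linarith
  refine (ENNReal.ofReal_le_ofReal h2).trans ?_
  rw [ENNReal.ofReal_sum_of_nonneg fun j _ => ht0 _ j]
  refine Finset.sum_le_sum fun j _ => le_iInf₂ fun b _ => ?_
  by_cases hb : b = top j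
  · subst hb
    simp only [t]
    rcases h : a (top j) j with _ | c
    · simp
    · exact le_iSup₂_of_le c ((ha _).mem j c h).1 le_rfl
  · exact le_iSup₂_of_le (top j) (by simp [Ne.symm hb]) (ENNReal.ofReal_le_ofReal (htle _ j))

theorem measurable_secondMax_column (N : Finset (Fin n)) (j : Fin m) :
    Measurable fun v : Profile n m => secondMax N fun i => v i j :=
  (measurable_secondMax N).comp (measurable_column j)

theorem measurable_bestWeight (M : Matroid (Fin m)) (A : Finset (Fin n)) (S : Finset (Fin m)) :
    Measurable (bestWeight M A S) := by
  refine Measurable.iSup fun a => Finset.measurable_fun_sum _ fun x _ => ?_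
  rcases a.1 x with _ | i
  · exact measurable_const
  · exact measurable_entry i x

theorem measurable_sum_vcgPayment (M : Matroid (Fin m)) :
    Measurable fun v : Profile n m => ∑ i, vcgPayment (matroidConstraint M) v i := by
  simp only [sum_vcgPayment]
  have h := measurable_bestWeight M (Finset.univ : Finset (Fin n)) Finset.univ
  exact (Finset.measurable_fun_sum _ fun i _ => measurable_bestWeight M _ _).sub
    ((h.const_mul _).sub h)

theorem vcgRevenue_unconstrained_le [NeZero n] {F : Fin m → Measure ℝ}
    [∀ x, IsProbabilityMeasure (F x)] (hF : ∀ x, ∀ᵐ t ∂F x, 0 ≤ t) :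
    vcgRevenue (unconstrained m) n F
      ≤ ∑ j, ∫⁻ v, secondMax Finset.univ (fun i => v i j) ∂profileLaw n F := by
  rw [← lintegral_finsetSum _ fun j _ => measurable_secondMax_column _ j]
  refine lintegral_mono_ae ?_
  filter_upwards [ae_profileLaw (S := fun _ => Set.Ici 0) hF] with v hv
  exact sum_vcgPayment_unconstrained_le hv

theorem bestWeight_mono_right {M : Matroid (Fin m)} {A : Finset (Fin n)} {S : Finset (Fin m)}
    {v w : Profile n m} (h : ∀ i x, v i x ≤ w i x) : bestWeight M A S v ≤ bestWeight M A S w := by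
  obtain ⟨a, ha, hav⟩ := exists_bestWeight M A S v
  rw [← hav]
  refine le_trans (Finset.sum_le_sum fun x _ => ?_) (allocWeight_le_bestWeight w ha)
  rcases a x with _ | i
  · exact le_rfl
  · exact h i x

theorem bestWeight_le_add {M : Matroid (Fin m)} {A : Finset (Fin n)} {S : Finset (Fin m)}
    {v w : Profile n m} {δ : ℝ} (hδ : 0 ≤ δ) (h : ∀ i x, w i x ≤ v i x + δ) :
    bestWeight M A S w ≤ bestWeight M A S v + m * δ := by
  obtain ⟨a, ha, hav⟩ := exists_bestWeight M A S w
  rw [← hav]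
  have h1 : allocWeight w a ≤ allocWeight v a + ∑ _x : Fin m, δ := by
    rw [allocWeight, allocWeight, ← Finset.sum_add_distrib]
    refine Finset.sum_le_sum fun x _ => ?_
    rcases a x with _ | i
    · simpa using hδ
    · exact h i x
  have h2 := allocWeight_le_bestWeight v ha
  simp only [Finset.sum_const, Finset.card_univ, Fintype.card_fin, nsmul_eq_mul] at h1
  linarith

theorem sum_vcgPayment_add_le [NeZero n] (M : Matroid (Fin m)) {v u : Profile n m} {δ : ℝ}
    (hδ : 0 ≤ δ) (hu : ∀ i x, u i x ∈ Set.Icc 0 δ) :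
    ∑ i, vcgPayment (matroidConstraint M) (v + u) i
      ≤ ∑ i, vcgPayment (matroidConstraint M) v i + n * (m * δ) := by
  rw [sum_vcgPayment, sum_vcgPayment]
  have h1 : ∑ i, bestWeight M (Finset.univ.erase i) Finset.univ (v + u)
      ≤ ∑ i, (bestWeight M (Finset.univ.erase i) Finset.univ v + m * δ) :=
    Finset.sum_le_sum fun i _ => bestWeight_le_add hδ fun l x => by
      simpa using (hu l x).2
  have h2 : bestWeight M Finset.univ Finset.univ v
      ≤ bestWeight M (Finset.univ : Finset (Fin n)) Finset.univ (v + u) :=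
    bestWeight_mono_right fun l x => by simpa using (hu l x).1
  have hn : (1 : ℝ) ≤ n := by exact_mod_cast NeZero.one_le
  have h3 := mul_le_mul_of_nonneg_left h2 (sub_nonneg.2 hn)
  simp only [Finset.sum_add_distrib, Finset.sum_const, Finset.card_univ, Fintype.card_fin,
    nsmul_eq_mul] at h1
  linarith

/-- The uniform distribution on `[0, δ]`. -/
def uniformLaw (δ : ℝ) : Measure ℝ :=
  volume.withDensity fun t => ENNReal.ofReal ((Set.Icc 0 δ).indicator (fun _ => δ⁻¹) t)

theorem uniformLaw_eq (δ : ℝ) :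
    uniformLaw δ = ENNReal.ofReal δ⁻¹ • volume.restrict (Set.Icc 0 δ) := by
  rw [uniformLaw, ← withDensity_const, ← withDensity_indicator measurableSet_Icc]
  congr 1
  ext t
  by_cases ht : t ∈ Set.Icc 0 δ <;> simp [ht]

theorem isProbabilityMeasure_uniformLaw {δ : ℝ} (hδ : 0 < δ) :
    IsProbabilityMeasure (uniformLaw δ) := by
  refine ⟨?_⟩
  rw [uniformLaw_eq, Measure.smul_apply, Measure.restrict_apply_univ, Real.volume_Icc, smul_eq_mul,
    ← ENNReal.ofReal_mul (inv_nonneg.2 hδ.le), sub_zero, inv_mul_cancel₀ hδ.ne', ENNReal.ofReal_one]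

theorem uniformLaw_singleton (δ t : ℝ) : uniformLaw δ {t} = 0 := by
  simp [uniformLaw_eq]

theorem ae_uniformLaw (δ : ℝ) : ∀ᵐ t ∂uniformLaw δ, t ∈ Set.Icc 0 δ := by
  rw [uniformLaw_eq]
  exact Measure.ae_smul_measure (ae_restrict_mem measurableSet_Icc) _

/-- The noise in the entry `(b, j)` shifts the score of `b` and leaves every other score alone, so
an atomless noise almost surely produces no ties. -/
theorem ae_exists_mem_winEvent [NeZero n] (M : Matroid (Fin m)) (j : Fin m)
    {F G : Fin m → Measure ℝ} [∀ x, IsProbabilityMeasure (F x)] [∀ x, IsProbabilityMeasure (G x)]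
    (hG : ∀ t, G j {t} = 0) :
    ∀ᵐ v ∂((profileLaw n F).prod (profileLaw n G)).map (fun q => q.1 + q.2),
      ∃ i, v ∈ winEvent M j i := by
  let s : Fin n → Profile n m → ℝ := fun b v => v b j + bestWeightErase M Finset.univ j (some b) v
  have hs : ∀ b, Measurable (s b) := fun b =>
    (measurable_entry b j).add (measurable_bestWeightErase M _ j _)
  have hne : ∀ b b', b ≠ b' →
      ∀ᵐ v ∂((profileLaw n F).prod (profileLaw n G)).map (fun q => q.1 + q.2), s b v ≠ s b' v := by
    intro b b' hbb'
    have hadd : Measurable fun q : Profile n m × Profile n m => q.1 + q.2 :=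
      measurable_fst.add measurable_snd
    have hset := measurableSet_eq_fun (hs b) (hs b')
    refine ae_iff.2 ?_
    simp only [not_not]
    rw [Measure.map_apply hadd hset, Measure.measure_prod_null (hadd hset)]
    refine Filter.Eventually.of_forall fun v => ?_
    have hv : Measurable fun u : Profile n m => v + u := measurable_const.add measurable_id
    have hκ : ∀ c u t, bestWeightErase M Finset.univ j (some c)
        (v + Function.update u b (Function.update (u b) j t))
        = bestWeightErase M Finset.univ j (some c) (v + u) := fun c u t => by
      refine bestWeightErase_congr fun i x hx => ?_
      by_cases hi : i = b
      · subst hi; simp [hx]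
      · simp [hi]
    refine measure_mono_null (fun u hu => ?_) (profileLaw_entry_eq_null (i := b) hG
      (h := fun u => s b' (v + u) - bestWeightErase M Finset.univ j (some b) (v + u) - v b j)
      ((((hs b').comp hv).sub ((measurable_bestWeightErase M _ j _).comp hv)).sub_const _)
      fun u t => ?_)
    · have hu' : v b j + u b j + bestWeightErase M Finset.univ j (some b) (v + u) = s b' (v + u) := hu
      simp only [Set.mem_ofPred_eq]
      linarith
    · simp only [s, hκ]
      simp [hbb'.symm]
  have hall : ∀ᵐ v ∂((profileLaw n F).prod (profileLaw n G)).map (fun q => q.1 + q.2),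
      ∀ b b', b ≠ b' → s b v ≠ s b' v :=
    ae_all_iff.2 fun b => ae_all_iff.2 fun b' => by
      by_cases h : b = b'
      · simp [h]
      · filter_upwards [hne b b' h] with v hv _ using hv
  filter_upwards [hall] with v hv
  obtain ⟨i, hi⟩ := Finite.exists_max fun b => s b v
  exact ⟨i, fun b hb => lt_of_le_of_ne (hi b) (hv b i hb)⟩

/-- With `ρ` additional bidders, the VCG revenue is at least the sum over all items that are not
loops of the expected second largest value. -/
theorem sum_lintegral_secondMax_le_vcgRevenue {M : Matroid (Fin m)} (hM : M.E = Set.univ)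
    {F : Fin m → Measure ℝ} [∀ x, IsProbabilityMeasure (F x)] {L : Finset (Fin m)}
    (hL : ∀ j ∈ L, M.Indep {j}) {k : ℕ} [NeZero k] (hk : k + disjointSpanningNumber M ≤ n) :
    ∑ j ∈ L, ∫⁻ v, secondMax Finset.univ (fun i => v i j) ∂profileLaw k F
      ≤ vcgRevenue (matroidConstraint M) n F := by
  have hkn : k ≤ n := le_of_add_le_left hk
  have hn0 : NeZero n := ⟨fun h => NeZero.ne k (by omega)⟩
  let N : Finset (Fin n) := Finset.univ.map (Fin.castLEEmb hkn)
  have hN : N.card = k := by simp [N]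
  have h1 : ∀ j, ∫⁻ v, secondMax Finset.univ (fun i => v i j) ∂profileLaw k F
      = ∫⁻ v, secondMax N (fun i => v i j) ∂profileLaw n F := fun j => by
    rw [← map_comp_profileLaw (Fin.castLEEmb hkn), lintegral_map
      (measurable_secondMax_column _ j) (measurable_pi_lambda _ fun i => measurable_pi_apply _)]
    refine lintegral_congr fun v => ?_
    rw [secondMax_map]
    rfl
  simp only [h1]
  refine ENNReal.le_of_forall_pos_le_add fun ε hε _ => ?_
  obtain ⟨δ, hδ, hδε⟩ : ∃ δ : ℝ, 0 < δ ∧ n * (m * δ) ≤ ε := by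
    refine ⟨ε / (n * m + 1), by positivity, ?_⟩
    have h0 : (0 : ℝ) < n * m + 1 := by positivity
    rw [← mul_assoc, mul_div_assoc', div_le_iff₀ h0]
    nlinarith [ε.2]
  have := isProbabilityMeasure_uniformLaw hδ
  let G : Fin m → Measure ℝ := fun _ => uniformLaw δ
  have hadd : Measurable fun q : Profile n m × Profile n m => q.1 + q.2 :=
    measurable_fst.add measurable_snd
  set μ := ((profileLaw n F).prod (profileLaw n G)).map fun q => q.1 + q.2 with hμ
  have hu : ∀ᵐ q ∂(profileLaw n F).prod (profileLaw n G), ∀ i x, q.2 i x ∈ Set.Icc 0 δ :=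
    Measure.quasiMeasurePreserving_snd.ae
      (ae_profileLaw (F := G) (S := fun _ => Set.Icc 0 δ) fun _ => ae_uniformLaw δ)
  have hperm : ∀ j σ, MeasurePreserving (permColumn j σ) μ μ := fun j σ => by
    refine ⟨measurable_permColumn j σ, ?_⟩
    have h2 := ((measurePreserving_permColumn (F := F) j σ).prod
      (measurePreserving_permColumn (F := G) (n := n) j σ)).map_eq
    rw [hμ, Measure.map_map (measurable_permColumn j σ) hadd]
    conv_rhs => rw [← h2, Measure.map_map hadd
      ((measurable_permColumn j σ).prodMap (measurable_permColumn j σ))]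
    congr 1
    ext q b x
    by_cases hx : x = j <;> simp [permColumn, hx]
  have key := sum_lintegral_secondMax_le hM hperm hL
    (fun j _ => ae_exists_mem_winEvent M j fun t => uniformLaw_singleton δ t) (N := N)
    (Finset.card_pos.1 (by rw [hN]; exact NeZero.pos k)) (by rwa [hN])
  calc ∑ j ∈ L, ∫⁻ v, secondMax N (fun i => v i j) ∂profileLaw n F
      ≤ ∑ j ∈ L, ∫⁻ v, secondMax N (fun i => v i j) ∂μ := Finset.sum_le_sum fun j _ => by
        have hm := measurable_secondMax_column N j
        have h3 : (profileLaw n F) = ((profileLaw n F).prod (profileLaw n G)).map Prod.fst := by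
          simp
        conv_lhs => rw [h3]
        rw [lintegral_map hm measurable_fst, hμ, lintegral_map hm hadd]
        refine lintegral_mono_ae ?_
        filter_upwards [hu] with q hq
        exact secondMax_mono_right N fun i => by simpa using (hq i j).1
    _ ≤ _ := key
    _ ≤ ∫⁻ q, ENNReal.ofReal (∑ i, vcgPayment (matroidConstraint M) (q.1 + q.2) i)
          ∂(profileLaw n F).prod (profileLaw n G) := lintegral_map_le _ _
    _ ≤ ∫⁻ q, (ENNReal.ofReal (∑ i, vcgPayment (matroidConstraint M) q.1 i) + ε)
          ∂(profileLaw n F).prod (profileLaw n G) := by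
        refine lintegral_mono_ae ?_
        filter_upwards [hu] with q hq
        refine (ENNReal.ofReal_le_ofReal ((sum_vcgPayment_add_le M hδ.le hq).trans
          (add_le_add_right hδε _))).trans (ENNReal.ofReal_add_le.trans ?_)
        rw [ENNReal.ofReal_coe_nnreal]
    _ = vcgRevenue (matroidConstraint M) n F + ε := by
        rw [lintegral_add_right _ measurable_const, lintegral_const, measure_univ, mul_one, vcgRevenue]
        congr 1
        have h3 : (profileLaw n F) = ((profileLaw n F).prod (profileLaw n G)).map Prod.fst := by
          simp
        conv_rhs => rw [h3]
        rw [lintegral_map (measurable_sum_vcgPayment M).ennreal_ofReal measurable_fst]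

end Revenue

/-! ### Transforming mechanisms: truncation to independent sets and change of value laws -/

theorem exists_measurableSet_selector {X K : Type*} [MeasurableSpace X] [Countable K]
    {P : X → K → Prop} (h : ∀ x, ∃ k, P x k) (hP : ∀ k, MeasurableSet {x | P x k}) :
    ∃ g : X → K, (∀ x, P x (g x)) ∧ ∀ k, MeasurableSet {x | g x = k} := by
  classical
  obtain ⟨f, hf⟩ := exists_injective_nat K
  have hp : ∀ x, ∃ N, ∃ k, f k = N ∧ P x k := fun x => by
    obtain ⟨k, hk⟩ := h x
    exact ⟨f k, k, rfl, hk⟩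
  choose g hg using fun x => Nat.find_spec (hp x)
  refine ⟨g, fun x => (hg x).2, fun k => ?_⟩
  have hm : Measurable fun x => Nat.find (hp x) := by
    refine measurable_find hp fun N => ?_
    have : {x | ∃ k, f k = N ∧ P x k} = ⋃ k, ⋃ _ : f k = N, {x | P x k} := by
      ext x; simp
    rw [this]
    exact MeasurableSet.iUnion fun k => MeasurableSet.iUnion fun _ => hP k
  have : {x | g x = k} = (fun x => Nat.find (hp x)) ⁻¹' {f k} := by
    ext x
    simp only [Set.mem_ofPred_eq, Set.mem_preimage, Set.mem_singleton_iff, ← (hg x).1, hf.eq_iff]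
  rw [this]
  exact hm (measurableSet_singleton _)

section Mechanisms

variable {n m : ℕ}

theorem value_unconstrained {t : Fin m → ℝ} (ht : ∀ j, 0 ≤ t j) (S : Finset (Fin m)) :
    value (unconstrained m) t S = ∑ j ∈ S, t j := by
  obtain ⟨T, hTS, -, hT⟩ := exists_sum_eq_value (𝓘 := unconstrained m) (Set.mem_univ _) t S
  refine le_antisymm ?_ (sum_le_value t subset_rfl (Set.mem_univ _))
  rw [← hT]
  exact Finset.sum_le_sum_of_subset_of_nonneg hTS fun j _ _ => ht j

theorem bundle_injective : Function.Injective (bundle : Allocation n m → Fin n → Finset (Fin m)) := by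
  intro a b h
  ext x i
  have := congrFun h i
  rw [Finset.ext_iff] at this
  simpa using this x

theorem Mechanism.alloc_le_one (A : Mechanism n m) (v : Profile n m) (a : Allocation n m) :
    A.alloc v a ≤ 1 := by
  rw [← A.sum_alloc v]
  exact Finset.single_le_sum (fun b _ => A.alloc_nonneg v b) (Finset.mem_univ a)

theorem Mechanism.integrable_utility (A : Mechanism n m) {F : Fin m → Measure ℝ}
    [∀ x, IsProbabilityMeasure (F x)] (hA : A.HasInterimPayments F) (i : Fin n)
    {r : Fin m → ℝ} (hr : r ∈ typeSpace F) (c : Allocation n m → ℝ) :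
    Integrable (fun v => ∑ a, A.alloc (Function.update v i r) a * c a
      - A.pay (Function.update v i r) i) (profileLaw n F) := by
  refine (integrable_finsetSum _ fun a _ => Integrable.mul_const ?_ _).sub (hA i r hr)
  have hm : Measurable fun v : Profile n m => Function.update v i r :=
    measurable_update_left
  refine Integrable.of_bound ((A.measurable_alloc a).comp hm).aestronglyMeasurable 1
    (Filter.Eventually.of_forall fun v => ?_)
  rw [Real.norm_eq_abs, abs_of_nonneg (A.alloc_nonneg _ _)]
  exact A.alloc_le_one _ _

/-- A mechanism for constrained bidders can be run with additive bidders, by giving every bidder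
only the best feasible part of her bundle. -/
theorem optRevenue_le_optRevenue_unconstrained {𝓘 : Set (Finset (Fin m))} (h𝓘 : ∅ ∈ 𝓘)
    {F : Fin m → Measure ℝ} [∀ x, IsProbabilityMeasure (F x)]
    (hF : ∀ x, (F x).support ⊆ Set.Ici 0) :
    optRevenue 𝓘 n F ≤ optRevenue (unconstrained m) n F := by
  refine iSup_le fun ⟨A, hpay, hBIC, hBIR⟩ => ?_
  have hsel : ∀ S : Finset (Fin m), ∃ T : (Fin m → ℝ) → Finset (Fin m),
      (∀ r, T r ⊆ S ∧ T r ∈ 𝓘 ∧ value 𝓘 r S ≤ ∑ j ∈ T r, r j)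
        ∧ ∀ T', MeasurableSet {r | T r = T'} := fun S => by
    refine exists_measurableSet_selector (P := fun r T => T ⊆ S ∧ T ∈ 𝓘 ∧ value 𝓘 r S ≤ ∑ j ∈ T, r j)
      (fun r => ?_) fun T => ?_
    · obtain ⟨T, h1, h2, h3⟩ := exists_sum_eq_value h𝓘 r S
      exact ⟨T, h1, h2, h3.ge⟩
    · refine MeasurableSet.inter (.const _) (MeasurableSet.inter (.const _) ?_)
      have hs : ∀ T : Finset (Fin m), Measurable fun r : Fin m → ℝ => ∑ j ∈ T, r j := fun T =>
        Finset.measurable_fun_sum _ fun j _ => measurable_pi_apply j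
      exact measurableSet_le (Measurable.iSup fun U : {U : Finset (Fin m) // U ⊆ S ∧ U ∈ 𝓘} => hs U.1) (hs T)
  choose T hT hTm using hsel
  let trunc : Profile n m → Allocation n m → Allocation n m := fun v b x =>
    (b x).bind fun i => if x ∈ T (bundle b i) (v i) then some i else none
  have hbundle : ∀ v b i, bundle (trunc v b) i = T (bundle b i) (v i) := fun v b i => by
    ext x
    simp only [mem_bundle, trunc]
    constructor
    · intro h
      rcases hb : b x with _ | k
      · simp [hb] at h
      · rw [hb, Option.bind_some] at h
        split_ifs at h with hk
        rwa [← Option.some.inj h]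
    · intro h
      have := (hT _ _).1 h
      rw [mem_bundle] at this
      simp [this, h]
  let A' : Mechanism n m :=
    { alloc := fun v a => ∑ b, if trunc v b = a then A.alloc v b else 0
      pay := A.pay
      alloc_nonneg := fun v a => Finset.sum_nonneg fun b _ => by
        split_ifs
        · exact A.alloc_nonneg v b
        · exact le_rfl
      sum_alloc := fun v => by
        rw [Finset.sum_comm]
        simpa using A.sum_alloc v
      measurable_alloc := fun a => Finset.measurable_fun_sum _ fun b _ => by
        refine Measurable.ite ?_ (A.measurable_alloc b) measurable_const
        have : {v | trunc v b = a} = ⋂ i, {v | T (bundle b i) (v i) = bundle a i} := by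
          ext v
          simp only [Set.mem_ofPred_eq, Set.mem_iInter, ← hbundle, ← bundle_injective.eq_iff,
            funext_iff]
        rw [this]
        exact MeasurableSet.iInter fun i =>
          measurable_pi_apply (X := fun _ : Fin n => Fin m → ℝ) i (hTm (bundle b i) (bundle a i))
      measurable_pay := A.measurable_pay }
  have ht0 : ∀ t ∈ typeSpace F, ∀ j, 0 ≤ t j := fun t ht j => hF j (ht j)
  have hU : ∀ i, ∀ t ∈ typeSpace F, ∀ r, A'.interimUtility (unconstrained m) F i t r
      = ∫ v, (∑ b, A.alloc (Function.update v i r) b * ∑ j ∈ T (bundle b i) r, t j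
        - A.pay (Function.update v i r) i) ∂profileLaw n F := fun i t ht r => by
    refine integral_congr_ae (Filter.Eventually.of_forall fun v => ?_)
    simp only [A']
    congr 1
    simp only [Finset.sum_mul, ite_mul, zero_mul]
    rw [Finset.sum_comm]
    refine Finset.sum_congr rfl fun b _ => ?_
    rw [Finset.sum_ite_eq, if_pos (Finset.mem_univ _), value_unconstrained (ht0 t ht), hbundle,
      Function.update_self]
  -- The truncated bundle is optimal for the report `r`. For the true type `t` it is just some
  -- feasible part of the bundle, so lies gain no more than before, while truthful utility is
  -- unchanged.
  have hle : ∀ i, ∀ t ∈ typeSpace F, ∀ r ∈ typeSpace F,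
      A'.interimUtility (unconstrained m) F i t r ≤ A.interimUtility 𝓘 F i t r :=
    fun i t ht r hr => by
      rw [hU i t ht r]
      refine integral_mono (A.integrable_utility hpay i hr fun b => ∑ j ∈ T (bundle b i) r, t j)
        (A.integrable_utility hpay i hr fun b => value 𝓘 t (bundle b i)) fun v => ?_
      refine sub_le_sub_right (Finset.sum_le_sum fun b _ => ?_) _
      exact mul_le_mul_of_nonneg_left (sum_le_value t (hT _ _).1 (hT _ _).2.1) (A.alloc_nonneg _ _)
  have heq : ∀ i, ∀ t ∈ typeSpace F,
      A'.interimUtility (unconstrained m) F i t t = A.interimUtility 𝓘 F i t t := fun i t ht => by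
    refine (hle i t ht t ht).antisymm ?_
    rw [hU i t ht t]
    refine integral_mono (A.integrable_utility hpay i ht fun b => value 𝓘 t (bundle b i))
      (A.integrable_utility hpay i ht fun b => ∑ j ∈ T (bundle b i) t, t j) fun v => ?_
    refine sub_le_sub_right (Finset.sum_le_sum fun b _ => ?_) _
    exact mul_le_mul_of_nonneg_left (hT _ _).2.2 (A.alloc_nonneg _ _)
  refine le_iSup_of_le ⟨A', hpay, fun i t ht r hr => ?_, fun i t ht => ?_⟩ le_rfl
  · rw [heq i t ht]
    exact (hle i t ht r hr).trans (hBIC i t ht r hr)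
  · rw [heq i t ht]
    exact hBIR i t ht

/-- A mechanism for the values `τ x (v i x)` can be run with the values `v i x`, if the bundle
values are the same. -/
theorem optRevenue_map_le {𝓘 : Set (Finset (Fin m))} {F : Fin m → Measure ℝ}
    [∀ x, IsProbabilityMeasure (F x)] {τ : Fin m → ℝ → ℝ} (hτ : ∀ x, Measurable (τ x))
    (hsupp : ∀ x, ∀ t ∈ (F x).support, τ x t ∈ ((F x).map (τ x)).support)
    (hval : ∀ t S, value 𝓘 (fun x => τ x (t x)) S = value 𝓘 t S) :
    optRevenue 𝓘 n (fun x => (F x).map (τ x)) ≤ optRevenue 𝓘 n F := by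
  refine iSup_le fun ⟨A, hpay, hBIC, hBIR⟩ => ?_
  let σ : Profile n m → Profile n m := fun v i x => τ x (v i x)
  have hσ : Measurable σ :=
    measurable_pi_lambda _ fun i => measurable_pi_lambda _ fun x => (hτ x).comp (measurable_entry i x)
  have hlaw : profileLaw n (fun x => (F x).map (τ x)) = (profileLaw n F).map σ :=
    (map_map_profileLaw hτ).symm
  have hup : ∀ v i r, σ (Function.update v i r) = Function.update (σ v) i fun x => τ x (r x) :=
    fun v i r => by
      ext b x
      by_cases hb : b = i
      · subst hb; simp [σ]
      · simp [σ, hb]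
  have htype : ∀ t ∈ typeSpace F, (fun x => τ x (t x)) ∈ typeSpace fun x => (F x).map (τ x) :=
    fun t ht x => hsupp x _ (ht x)
  let A' : Mechanism n m :=
    { alloc := fun v => A.alloc (σ v)
      pay := fun v => A.pay (σ v)
      alloc_nonneg := fun v => A.alloc_nonneg (σ v)
      sum_alloc := fun v => A.sum_alloc (σ v)
      measurable_alloc := fun a => (A.measurable_alloc a).comp hσ
      measurable_pay := fun i => (A.measurable_pay i).comp hσ }
  have hpm : ∀ i (r : Fin m → ℝ), Measurable fun v : Profile n m => A.pay (Function.update v i r) i :=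
    fun i r => (A.measurable_pay i).comp measurable_update_left
  have hU : ∀ i t r, A'.interimUtility 𝓘 F i t r
      = A.interimUtility 𝓘 (fun x => (F x).map (τ x)) i (fun x => τ x (t x)) fun x => τ x (r x) :=
    fun i t r => by
      rw [Mechanism.interimUtility, Mechanism.interimUtility, hlaw, integral_map hσ.aemeasurable]
      · simp only [A', hup, hval]
      · refine Measurable.aestronglyMeasurable (Measurable.sub ?_ (hpm i _))
        exact Finset.measurable_fun_sum _ fun a _ =>
          ((A.measurable_alloc a).comp measurable_update_left).mul_const _
  refine le_iSup_of_le ⟨A', fun i r hr => ?_, fun i t ht r hr => ?_, fun i t ht => ?_⟩ (le_of_eq ?_)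
  · have := hpay i _ (htype r hr)
    rw [hlaw, integrable_map_measure (hpm i _).aestronglyMeasurable hσ.aemeasurable] at this
    simp only [A', hup]
    exact this
  · rw [hU, hU]
    exact hBIC i _ (htype t ht) _ (htype r hr)
  · rw [hU]
    exact hBIR i _ (htype t ht)
  · simp only [Mechanism.revenue, hlaw, A']
    refine Finset.sum_congr rfl fun i _ => ?_
    rw [lintegral_map (A.measurable_pay i).ennreal_ofReal hσ,
      lintegral_map (f := fun v => ENNReal.ofReal (-A.pay v i))
        (A.measurable_pay i).neg.ennreal_ofReal hσ]

theorem value_congr_of_forall_indep {M : Matroid (Fin m)} {t t' : Fin m → ℝ}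
    (h : ∀ x, M.Indep {x} → t x = t' x) (S : Finset (Fin m)) :
    value (matroidConstraint M) t S = value (matroidConstraint M) t' S :=
  iSup_congr fun T => Finset.sum_congr rfl fun x hx => h x <| Matroid.Indep.subset
    (show M.Indep (T.1 : Set (Fin m)) from T.2.2) (by simpa using hx)

theorem bestWeight_congr_of_forall_indep {M : Matroid (Fin m)} {v w : Profile n m}
    (h : ∀ i x, M.Indep {x} → v i x = w i x) (A : Finset (Fin n)) (S : Finset (Fin m)) :
    bestWeight M A S v = bestWeight M A S w := by
  refine iSup_congr fun a => Finset.sum_congr rfl fun x _ => ?_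
  rcases hx : a.1 x with _ | i
  · rfl
  · exact h i x ((a.2.indep i).subset (by simpa using hx))

theorem vcgRevenue_map {M : Matroid (Fin m)} {F : Fin m → Measure ℝ}
    [∀ x, IsProbabilityMeasure (F x)] {τ : Fin m → ℝ → ℝ} (hτ : ∀ x, Measurable (τ x))
    (h : ∀ x, M.Indep {x} → τ x = id) :
    vcgRevenue (matroidConstraint M) n (fun x => (F x).map (τ x))
      = vcgRevenue (matroidConstraint M) n F := by
  have hm : Measurable fun (v : Profile n m) i x => τ x (v i x) :=
    measurable_pi_lambda _ fun i => measurable_pi_lambda _ fun x => (hτ x).comp (measurable_entry i x)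
  rw [vcgRevenue, ← map_map_profileLaw hτ, lintegral_map
    (measurable_sum_vcgPayment M).ennreal_ofReal hm, vcgRevenue]
  refine lintegral_congr fun v => ?_
  have : ∀ A S, bestWeight M A S (fun i x => τ x (v i x)) = bestWeight M A S v := fun A S =>
    bestWeight_congr_of_forall_indep (fun i x hx => by rw [h x hx, id]) A S
  simp only [sum_vcgPayment, this]

end Mechanisms

/-! ### Regular laws close to zero that simulate a given law -/

section SmallLaws

theorem uniformLaw_eq_map {ε : ℝ} (hε : 0 < ε) :
    uniformLaw ε = Measure.map (fun u : unitInterval => ε * (u : ℝ)) volume := by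
  have h1 : Measurable fun t : ℝ => ε * t := measurable_const_mul ε
  have h2 : (fun t : ℝ => ε * t) ⁻¹' Set.Icc 0 ε = unitInterval := by
    ext t
    simp only [Set.mem_preimage, Set.mem_Icc]
    constructor
    · rintro ⟨h, h'⟩
      exact ⟨by nlinarith, by nlinarith⟩
    · rintro ⟨h, h'⟩
      exact ⟨by nlinarith, by nlinarith⟩
  have h3 := Measure.restrict_map (μ := volume) h1 (measurableSet_Icc (a := (0 : ℝ)) (b := ε))
  rw [Real.map_volume_mul_left hε.ne', h2, ← unitInterval.measurePreserving_coe.map_eq,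
    Measure.map_map h1 measurable_subtype_coe, Measure.restrict_smul,
    abs_of_pos (inv_pos.2 hε)] at h3
  rw [uniformLaw_eq, h3]
  rfl

theorem isRegularContinuous_uniformLaw {ε : ℝ} (hε : 0 < ε) :
    IsRegularContinuous (uniformLaw ε) := by
  have := isProbabilityMeasure_uniformLaw hε
  refine ⟨this, Set.Icc 0 ε, (Set.Icc 0 ε).indicator fun _ => ε⁻¹, Set.ordConnected_Icc,
    fun t ht => ht.1, measurable_const.indicator measurableSet_Icc, fun v hv => ?_, fun v hv => ?_,
    rfl, fun v hv w hw hvw => ?_⟩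
  · rw [Set.indicator_of_mem hv]
    exact inv_pos.2 hε
  · exact Set.indicator_of_notMem hv _
  · simp only [Set.indicator_of_mem hv, Set.indicator_of_mem hw]
    have h : (uniformLaw ε).real (Set.Ioi w) ≤ (uniformLaw ε).real (Set.Ioi v) :=
      measureReal_mono (Set.Ioi_subset_Ioi hvw)
    exact sub_le_sub hvw (div_le_div_of_nonneg_right h (inv_pos.2 hε).le)

theorem isRegularFinite_map_mul {μ : Measure ℝ} (hμ : IsRegularFinite μ) {c : ℝ} (hc : 0 < c) :
    IsRegularFinite (μ.map (c * ·)) := by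
  have := hμ.isProbabilityMeasure
  obtain ⟨T, hT0, hTpos, hTc, hmono⟩ := hμ.exists_support
  have hm : Measurable fun t : ℝ => c * t := measurable_const_mul c
  have hinj : Function.Injective fun t : ℝ => c * t := mul_right_injective₀ hc.ne'
  have hsing : ∀ v, (μ.map (c * ·)).real {c * v} = μ.real {v} := fun v => by
    rw [map_measureReal_apply hm (measurableSet_singleton _)]
    congr 1
    ext t
    simp [hc.ne']
  have hIoi : ∀ v, (μ.map (c * ·)).real (Set.Ioi (c * v)) = μ.real (Set.Ioi v) := fun v => by
    rw [map_measureReal_apply hm measurableSet_Ioi]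
    congr 1
    ext t
    exact ⟨fun h => lt_of_mul_lt_mul_left h hc.le, fun h => mul_lt_mul_of_pos_left h hc⟩
  refine ⟨Measure.isProbabilityMeasure_map hm.aemeasurable, T.map ⟨_, hinj⟩, ?_, ?_, ?_, ?_⟩
  · simp only [Finset.mem_map, Function.Embedding.coeFn_mk]
    rintro _ ⟨v, hv, rfl⟩
    exact mul_nonneg hc.le (hT0 v hv)
  · simp only [Finset.mem_map, Function.Embedding.coeFn_mk]
    rintro _ ⟨v, hv, rfl⟩
    rw [hsing]
    exact hTpos v hv
  · rw [Measure.map_apply hm (Finset.measurableSet _).compl]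
    convert hTc using 2
    ext t
    simp [hc.ne']
  · simp only [Finset.coe_map, Function.Embedding.coeFn_mk]
    rintro _ ⟨v, hv, rfl⟩ _ ⟨w, hw, rfl⟩ hvw
    have hvw' : v ≤ w := le_of_mul_le_mul_left hvw hc
    have hInf : ∀ v, sInf {w | w ∈ T.map ⟨fun t : ℝ => c * t, hinj⟩ ∧ c * v < w}
        = c * sInf {w | w ∈ T ∧ v < w} := fun v => by
      have h := Real.sInf_smul_of_nonneg hc.le {w | w ∈ T ∧ v < w}
      rw [smul_eq_mul] at h
      rw [← h]
      congr 1
      ext t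
      simp only [Finset.mem_map, Function.Embedding.coeFn_mk, Set.mem_ofPred_eq, Set.mem_smul_set,
        smul_eq_mul]
      constructor
      · rintro ⟨⟨u, hu, rfl⟩, h⟩
        exact ⟨u, ⟨hu, lt_of_mul_lt_mul_left h hc.le⟩, rfl⟩
      · rintro ⟨u, ⟨hu, h⟩, rfl⟩
        exact ⟨⟨u, hu, rfl⟩, mul_lt_mul_of_pos_left h hc⟩
    have key := mul_le_mul_of_nonneg_left (hmono hv hw hvw') hc.le
    simp only [hsing, hIoi, hInf]
    refine le_of_eq_of_le ?_ (key.trans_eq ?_) <;> ring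

/-- Incentive constraints are imposed at every type in the support, not just almost surely, so `τ`
is corrected on a null set to take values in the support of `μ` everywhere. -/
theorem exists_map_eq_of_map_eq {μ ν : Measure ℝ} [IsProbabilityMeasure μ] {τ : ℝ → ℝ}
    (hτ : Measurable τ) (h : ν.map τ = μ) :
    ∃ τ' : ℝ → ℝ, Measurable τ' ∧ ν.map τ' = μ ∧ ∀ t, τ' t ∈ μ.support := by
  classical
  obtain ⟨t₀, ht₀⟩ := Measure.nonempty_support (IsProbabilityMeasure.ne_zero μ)
  have hs : MeasurableSet μ.support := Measure.isClosed_support.measurableSet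
  refine ⟨fun t => if τ t ∈ μ.support then τ t else t₀, Measurable.ite (hτ hs) hτ measurable_const,
    ?_, fun t => ?_⟩
  · refine (Measure.map_congr ?_).trans h
    have h1 : ∀ᵐ s ∂ν.map τ, s ∈ μ.support := by rw [h]; exact Measure.support_mem_ae
    filter_upwards [ae_of_ae_map hτ.aemeasurable h1] with t ht
    exact if_pos ht
  · dsimp only
    split_ifs with ht
    · exact ht
    · exact ht₀

/-- In the continuous class, every law is a measurable image of the uniform law on `[0, ε]`, which
is regular. In the finite class, the law itself is scaled down, which scales its virtual value, and
`τ` scales it back. -/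
theorem exists_small_law {𝒟 : Measure ℝ → Prop}
    (h𝒟 : 𝒟 = IsRegularContinuous ∨ 𝒟 = IsRegularFinite) {μ : Measure ℝ} (hμ : 𝒟 μ) {ε : ℝ}
    (hε : 0 < ε) : ∃ (ν : Measure ℝ) (τ : ℝ → ℝ), 𝒟 ν ∧ (∀ᵐ t ∂ν, t ≤ ε) ∧ Measurable τ ∧
      ν.map τ = μ ∧ ∀ t, τ t ∈ μ.support := by
  rcases h𝒟 with rfl | rfl
  · have := hμ.isProbabilityMeasure
    obtain ⟨f, hf, hfμ⟩ := Measure.exists_measurable_map_eq μ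
    have hτ : Measurable fun t : ℝ => f (Set.projIcc 0 1 zero_le_one (t / ε)) :=
      hf.comp (continuous_projIcc.measurable.comp (measurable_id.div_const ε))
    obtain ⟨τ, h1, h2, h3⟩ := exists_map_eq_of_map_eq (ν := uniformLaw ε) (μ := μ) hτ (by
      rw [uniformLaw_eq_map hε, Measure.map_map hτ (by fun_prop), ← hfμ]
      refine congrArg (fun g => Measure.map g volume) (funext fun u => ?_)
      simp only [Function.comp_apply, mul_div_cancel_left₀ _ hε.ne']
      rw [Set.projIcc_val])
    exact ⟨uniformLaw ε, τ, isRegularContinuous_uniformLaw hε,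
      (ae_uniformLaw ε).mono fun t ht => ht.2, h1, h2, h3⟩
  · have := hμ.isProbabilityMeasure
    obtain ⟨T, hT0, -, hTc, -⟩ := hμ.exists_support
    set C : ℝ := 1 + ∑ t ∈ T, t with hC
    have hCpos : 0 < C := add_pos_of_pos_of_nonneg one_pos (Finset.sum_nonneg hT0)
    have hc : 0 < ε / C := div_pos hε hCpos
    have hm : Measurable fun t : ℝ => ε / C * t := measurable_const_mul _
    obtain ⟨τ, h1, h2, h3⟩ := exists_map_eq_of_map_eq (ν := μ.map (ε / C * ·)) (μ := μ)
      (measurable_const_mul (ε / C)⁻¹) (by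
        rw [Measure.map_map (measurable_const_mul _) hm]
        convert Measure.map_id
        ext t
        exact inv_mul_cancel_left₀ hc.ne' t)
    refine ⟨_, τ, isRegularFinite_map_mul hμ hc, ?_, h1, h2, h3⟩
    rw [ae_map_iff hm.aemeasurable measurableSet_Iic]
    have hT : ∀ᵐ t ∂μ, t ∈ (T : Set ℝ) := hTc
    filter_upwards [hT] with t ht
    have h4 : t ≤ C := by
      have := Finset.single_le_sum hT0 ht
      linarith
    rw [div_mul_eq_mul_div, div_le_iff₀ hCpos]
    exact mul_le_mul_of_nonneg_left h4 hε.le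

theorem isProbabilityMeasure_of_regular {𝒟 : Measure ℝ → Prop}
    (h𝒟 : 𝒟 = IsRegularContinuous ∨ 𝒟 = IsRegularFinite) {μ : Measure ℝ} (hμ : 𝒟 μ) :
    IsProbabilityMeasure μ := by
  rcases h𝒟 with rfl | rfl
  · exact hμ.isProbabilityMeasure
  · exact hμ.isProbabilityMeasure

theorem ae_nonneg_of_regular {𝒟 : Measure ℝ → Prop}
    (h𝒟 : 𝒟 = IsRegularContinuous ∨ 𝒟 = IsRegularFinite) {μ : Measure ℝ} (hμ : 𝒟 μ) :
    ∀ᵐ t ∂μ, 0 ≤ t := by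
  rcases h𝒟 with rfl | rfl
  · obtain ⟨T, f, -, hT, hf, -, hf0, rfl, -⟩ := hμ.exists_density
    rw [ae_withDensity_iff hf.ennreal_ofReal]
    refine Filter.Eventually.of_forall fun t ht => hT ?_
    by_contra htT
    simp [hf0 t htT] at ht
  · obtain ⟨T, hT0, -, hTc, -⟩ := hμ.exists_support
    have hT : ∀ᵐ t ∂μ, t ∈ (T : Set ℝ) := hTc
    exact hT.mono hT0

end SmallLaws

/-! ### Assembly of the inequalities -/

theorem vcgBeatsOpt_matroidConstraint {n m : ℕ} {M : Matroid (Fin m)} (hM : M.E = Set.univ)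
    {𝒟 : Measure ℝ → Prop} (h𝒟 : 𝒟 = IsRegularContinuous ∨ 𝒟 = IsRegularFinite) {X c : ℕ}
    (hX : VCGBeatsOpt 𝒟 (unconstrained m) n X) (hc : X + disjointSpanningNumber M ≤ c) :
    VCGBeatsOpt 𝒟 (matroidConstraint M) n c := by
  classical
  intro F hF
  suffices h : ∀ ε : ℝ, 0 < ε → optRevenue (matroidConstraint M) n F
      ≤ ((vcgRevenue (matroidConstraint M) (n + c) F + m * ENNReal.ofReal ε : ℝ≥0∞) : EReal) by
    refine ((le_max_right 0 _).trans_eq EReal.coe_toENNReal_eq_max.symm).trans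
      (EReal.coe_ennreal_le_coe_ennreal_iff.2 ?_)
    refine ENNReal.le_of_forall_pos_le_add fun ε hε _ => ?_
    have hε' : (0 : ℝ) < ε / (m + 1) := by positivity
    have h1 := EReal.toENNReal_le_toENNReal (h _ hε')
    rw [EReal.toENNReal_coe] at h1
    refine h1.trans (add_le_add_right ?_ _)
    rw [← ENNReal.ofReal_natCast, ← ENNReal.ofReal_mul (Nat.cast_nonneg m),
      ← ENNReal.ofReal_coe_nnreal]
    refine ENNReal.ofReal_le_ofReal ?_
    rw [mul_div_assoc', div_le_iff₀ (by positivity)]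
    nlinarith [ε.2]
  intro ε hε
  -- Laws of non-loops are kept. Those of loops become small, which changes neither the bundle
  -- values nor the VCG revenue under the matroid.
  have hex : ∀ x, ∃ (ν : Measure ℝ) (τ : ℝ → ℝ), 𝒟 ν ∧ Measurable τ ∧ ν.map τ = F x ∧
      (∀ t ∈ ν.support, τ t ∈ (F x).support) ∧ (M.Indep {x} → τ = id) ∧
      (¬ M.Indep {x} → ∀ᵐ t ∂ν, t ≤ ε) := fun x => by
    by_cases hx : M.Indep {x}
    · exact ⟨F x, id, hF x, measurable_id, Measure.map_id, fun t ht => ht, fun _ => rfl,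
        fun h => absurd hx h⟩
    · obtain ⟨ν, τ, h1, h2, h3, h4, h5⟩ := exists_small_law h𝒟 (hF x) hε
      exact ⟨ν, τ, h1, h3, h4, fun t _ => h5 t, fun h => absurd h hx, fun _ => h2⟩
  choose G τ hG hτ hmap hsupp hid hsmall using hex
  obtain rfl : F = fun x => (G x).map (τ x) := funext fun x => (hmap x).symm
  have hprob : ∀ x, IsProbabilityMeasure (G x) := fun x => isProbabilityMeasure_of_regular h𝒟 (hG x)
  have hnn : ∀ x, ∀ᵐ t ∂G x, 0 ≤ t := fun x => ae_nonneg_of_regular h𝒟 (hG x)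
  have hval : ∀ t S, value (matroidConstraint M) (fun x => τ x (t x)) S
      = value (matroidConstraint M) t S := fun t S =>
    value_congr_of_forall_indep (fun x hx => by rw [hid x hx, id]) S
  rw [vcgRevenue_map hτ hid]
  refine (optRevenue_map_le hτ hsupp hval).trans
    ((optRevenue_le_optRevenue_unconstrained (empty_mem_matroidConstraint M) fun x =>
      Measure.support_subset_of_isClosed isClosed_Ici (hnn x)).trans ((hX G hG).trans ?_))
  rw [EReal.coe_ennreal_le_coe_ennreal_iff]
  -- With no bidders at all, `secondMax` is an infimum over the empty set, hence `⊤`, and would give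
  -- no bound.
  rcases Nat.eq_zero_or_pos (n + X) with h0 | hpos
  · have hzero : vcgRevenue (unconstrained m) (n + X) G = 0 := by
      rw [h0]
      simp [vcgRevenue]
    rw [hzero]
    exact zero_le
  have hk : NeZero (n + X) := ⟨hpos.ne'⟩
  refine (vcgRevenue_unconstrained_le hnn).trans ?_
  rw [← Finset.sum_filter_add_sum_filter_not Finset.univ fun x => M.Indep {x}]
  refine add_le_add (sum_lintegral_secondMax_le_vcgRevenue hM
    (fun j hj => (Finset.mem_filter.1 hj).2) (by omega)) ?_
  refine (Finset.sum_le_card_nsmul _ _ (ENNReal.ofReal ε) fun j hj => ?_).trans ?_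
  · have hj' := (Finset.mem_filter.1 hj).2
    have h1 : ∀ᵐ v ∂profileLaw (n + X) G, ∀ i x, v i x ∈ if x = j then Set.Iic ε else Set.univ :=
      ae_profileLaw (S := fun x => if x = j then Set.Iic ε else Set.univ) fun x => by
        by_cases hx : x = j
        · subst hx
          simpa using hsmall x hj'
        · simp [hx]
    calc ∫⁻ v, secondMax Finset.univ (fun i => v i j) ∂profileLaw (n + X) G
        ≤ ∫⁻ _, ENNReal.ofReal ε ∂profileLaw (n + X) G := by
          refine lintegral_mono_ae ?_
          filter_upwards [h1] with v hv
          refine (secondMax_le (Finset.mem_univ 0) _).trans (iSup₂_le fun i _ => ?_)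
          exact ENNReal.ofReal_le_ofReal (by simpa using hv i j)
      _ = ENNReal.ofReal ε := by simp
  · rw [nsmul_eq_mul]
    refine mul_le_mul_left ?_ _
    exact_mod_cast (Finset.card_le_univ _).trans (by simp)

/-- A finite infimum of natural numbers in `ℕ∞` is attained. -/
theorem vcgBeatsOpt_of_competitionComplexity_eq {n m X : ℕ} {𝒟 : Measure ℝ → Prop}
    {𝓘 : Set (Finset (Fin m))} (h : competitionComplexity 𝒟 𝓘 n = X) : VCGBeatsOpt 𝒟 𝓘 n X := by
  by_contra hX
  have h1 : ((X + 1 : ℕ) : ℕ∞) ≤ X ∨ ∃ c < X, VCGBeatsOpt 𝒟 𝓘 n c := by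
    by_contra! hcon
    refine absurd (le_of_le_of_eq (le_iInf₂ fun c hc => ?_) h) (not_le.2 hcon.1)
    rw [Nat.cast_le]
    rcases lt_trichotomy c X with hlt | rfl | hlt
    · exact absurd hc (hcon.2 c hlt)
    · exact absurd hc hX
    · exact hlt
  rcases h1 with h1 | ⟨c, hcX, hc⟩
  · exact absurd h1 (by rw [Nat.cast_le]; omega)
  · have h2 : competitionComplexity 𝒟 𝓘 n ≤ c := iInf₂_le c hc
    rw [h, Nat.cast_le] at h2
    omega

end Auction

end

theorem mainTheorem4 (n m : ℕ) (M : Matroid (Fin m)) (hM : M.E = Set.univ)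
    (𝒟 : MeasureTheory.Measure ℝ → Prop)
    (h𝒟 : 𝒟 = Auction.IsRegularContinuous ∨ 𝒟 = Auction.IsRegularFinite) :
    Auction.competitionComplexity 𝒟 (Auction.matroidConstraint M) n
        ≤ Auction.competitionComplexity 𝒟 (Auction.unconstrained m) n
          + (Auction.disjointSpanningNumber M : ℕ∞) ∧
      ∀ c : ℕ,
        Auction.competitionComplexity 𝒟 (Auction.unconstrained m) n
            + (Auction.disjointSpanningNumber M : ℕ∞) ≤ (c : ℕ∞) →
          Auction.VCGBeatsOpt 𝒟 (Auction.matroidConstraint M) n c := by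
  -- If the additive competition complexity is infinite, the bound is vacuous and no natural number
  -- `c` reaches it.
  by_cases hX : Auction.competitionComplexity 𝒟 (Auction.unconstrained m) n = ⊤
  · simp [hX]
  · obtain ⟨X, hX⟩ := ENat.ne_top_iff_exists.1 hX
    have h := Auction.vcgBeatsOpt_of_competitionComplexity_eq hX.symm
    rw [← hX]
    refine ⟨?_, fun c hc => Auction.vcgBeatsOpt_matroidConstraint hM h𝒟 h (by exact_mod_cast hc)⟩
    exact (iInf₂_le (X + Auction.disjointSpanningNumber M)
      (Auction.vcgBeatsOpt_matroidConstraint hM h𝒟 h le_rfl)).trans_eq (by push_cast; rfl)
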